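/- Let $A$ be a noetherian normal ring in which $2$ is invertible (normal: the localization of $A$ at every prime is an integrally closed domain). Let $n\ge 0$, let $g(v)=\sum_{i=0}^n a_{2n-2i}v^i\in A[v]$ be monic of degree $n$ (so $a_0=1$), put $f(u)=g(u^2)=\sum_{i=0}^n a_{2n-2i}u^{2i}$, and let $\alpha\in A$ satisfy $\alpha^2=(-1)^n a_{2n}$. The type D splitting ring $B=\mathrm{DSplit}_A(f,\alpha)$ is the quotient of $A[\eta_1,\dots,\eta_n]$ by the ideal generated by the coefficients (in $u$) of $f(u)-\prod_{i=1}^n(u^2-\eta_i^2)$ together with $\eta_1\cdots\eta_n-\alpha$. The reduced discriminant of $(f,\alpha)$ is $\overline{\Delta}=\alpha\cdot\mathrm{disc}(g)\in A$. An element $a\in A$ is called squarefree if $v_{\mathfrak p}(a)\in\{0,1\}$ for every height one prime $\mathfrak p$ of $A$, where $v_{\mathfrak p}$ is the valuation of the discrete valuation ring $A_{\mathfrak p}$. A subset of $\mathrm{Spec}(A)$ has codimension $\ge 2$ if every prime in it has height $\ge 2$. Let $\widetilde E\subset\mathrm{Spec}(B)$ be the locus where at least two of the $n+\binom n2$ equations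 $\eta_i=0$ ($1\le i\le n$) and $\eta_i^2=\eta_j^2$ ($1\le i<j\le n$) hold, and let $E\subset\mathrm{Spec}(A)$ be the image of $\widetilde E$. Let $V(\overline{\Delta},\partial\overline{\Delta})\subset\mathrm{Spec}(A)$ be the set of primes $\mathfrak p$ such that the image of $\overline{\Delta}$ in $A_{\mathfrak p}$ lies in $(\mathfrak pA_{\mathfrak p})^2$. Suppose that $\overline{\Delta}$ is a non-zerodivisor in $A$. 1. If $\overline{\Delta}$ is squarefree and $E$ has codimension $\ge 2$ in $\mathrm{Spec}(A)$, then $B$ is normal. 2. If $V(\overline{\Delta},\partial\overline{\Delta})$ has codimension $\ge 2$ in $\mathrm{Spec}(A)$, then $\overline{\Delta}$ is squarefree and $B$ is normal. -/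

import Mathlib

open Polynomial

noncomputable section

namespace TypeD

universe u

/-- A ring is normal if its localization at every prime ideal is an integrally closed domain. -/
class IsNormalRing (R : Type u) [CommRing R] : Prop where
  isDomain_localization (x : PrimeSpectrum R) :
    IsDomain (Localization.AtPrime x.asIdeal)
  isIntegrallyClosed_localization (x : PrimeSpectrum R) :
    IsIntegrallyClosed (Localization.AtPrime x.asIdeal)

instance (R : Type u) [CommRing R] [IsNormalRing R] (x : PrimeSpectrum R) :
    IsDomain (Localization.AtPrime x.asIdeal) :=
  IsNormalRing.isDomain_localization x

instance (R : Type u) [CommRing R] [IsNormalRing R] (x : PrimeSpectrum R) :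
    IsIntegrallyClosed (Localization.AtPrime x.asIdeal) :=
  IsNormalRing.isIntegrallyClosed_localization x

/-- The local ring of a noetherian normal ring at a height one prime is a discrete valuation
ring. -/
theorem isDiscreteValuationRing_localization (R : Type u) [CommRing R] [IsNoetherianRing R]
    [IsNormalRing R] (x : PrimeSpectrum R) (hx : x.asIdeal.height = 1) :
    IsDiscreteValuationRing (Localization.AtPrime x.asIdeal) := by
  have hdim : ringKrullDim (Localization.AtPrime x.asIdeal) = 1 := by
    rw [IsLocalization.AtPrime.ringKrullDim_eq_height x.asIdeal, hx]
    rfl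
  have hfield : ¬ IsField (Localization.AtPrime x.asIdeal) := by
    intro h
    rw [ringKrullDim_eq_zero_of_isField h] at hdim
    exact zero_ne_one hdim
  have : Ring.KrullDimLE 1 (Localization.AtPrime x.asIdeal) :=
    (Ring.krullDimLE_iff).2 hdim.le
  have hbot : IsLocalRing.maximalIdeal (Localization.AtPrime x.asIdeal) ≠ ⊥ :=
    IsLocalRing.isField_iff_maximalIdeal_eq.not.mp hfield
  have htfae := (IsDiscreteValuationRing.TFAE _ hfield).out 0 3
  rw [htfae]
  refine ⟨inferInstance, IsLocalRing.maximalIdeal _, ⟨hbot, inferInstance⟩, ?_⟩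
  rintro P ⟨hP, hPp⟩
  exact IsLocalRing.eq_maximalIdeal
    (Ring.krullDimLE_one_iff_of_isPrime_bot.1 this P hP hPp)

/-- The (additive) valuation `v_𝔭(a)` of an element `a` of a noetherian normal ring at a height one
prime `𝔭`. -/
def primeVal {R : Type u} [CommRing R] [IsNoetherianRing R] [IsNormalRing R]
    (x : PrimeSpectrum R) (hx : x.asIdeal.height = 1) (a : R) : ℕ∞ :=
  letI := isDiscreteValuationRing_localization R x hx
  IsDiscreteValuationRing.addVal (Localization.AtPrime x.asIdeal)
    (algebraMap R (Localization.AtPrime x.asIdeal) a)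

/-- An element of a noetherian normal ring is squarefree if its valuation at each height one prime
is `0` or `1`. -/
def IsSquarefreeElt {R : Type u} [CommRing R] [IsNoetherianRing R] [IsNormalRing R]
    (a : R) : Prop :=
  ∀ (x : PrimeSpectrum R) (hx : x.asIdeal.height = 1), primeVal x hx a = 0 ∨ primeVal x hx a = 1

/-- A subset of the spectrum has codimension at least `c` if all primes it contains have height at
least `c`. -/
def CodimGE {R : Type u} [CommRing R] (c : ℕ∞) (S : Set (PrimeSpectrum R)) : Prop :=
  ∀ x ∈ S, c ≤ x.asIdeal.height

/-- The set of points of the spectrum at which `a` vanishes to order two: the image of `a` in the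
local ring at the point lies in the square of the maximal ideal. -/
def doubleVanishing {R : Type u} [CommRing R] (a : R) : Set (PrimeSpectrum R) :=
  {x | algebraMap R (Localization.AtPrime x.asIdeal) a ∈
    IsLocalRing.maximalIdeal (Localization.AtPrime x.asIdeal) ^ 2}

section Splitting

variable {A : Type u} [CommRing A]

/-- The polynomial `f(u) - ∏ᵢ (u² - ηᵢ²)` in `u`, where `f(u) = g(u²)`, with coefficients in the
polynomial ring `A[η₁, …, ηₙ]`. -/
def splitDiff (n : ℕ) (g : A[X]) : (MvPolynomial (Fin n) A)[X] :=
  (expand A 2 g).map MvPolynomial.C -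
    ∏ i : Fin n, (X ^ 2 - C (MvPolynomial.X i ^ 2))

/-- The ideal of `A[η₁, …, ηₙ]` generated by equating the coefficients of `f(u) = ∏ᵢ (u² - ηᵢ²)`,
where `f(u) = g(u²)`, together with the equation `η₁ ⋯ ηₙ = α`. -/
def splitIdeal (n : ℕ) (g : A[X]) (α : A) : Ideal (MvPolynomial (Fin n) A) :=
  Ideal.span (Set.range (fun k : ℕ => (splitDiff n g).coeff k) ∪
    {∏ i : Fin n, MvPolynomial.X i - MvPolynomial.C α})

/-- The type D splitting ring of the pair `(f, α)`, where `f(u) = g(u²)`. -/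
abbrev DSplit (n : ℕ) (g : A[X]) (α : A) : Type u :=
  MvPolynomial (Fin n) A ⧸ splitIdeal n g α

/-- The class of the `i`-th variable in the type D splitting ring. -/
def etaRoot (n : ℕ) (g : A[X]) (α : A) (i : Fin n) : DSplit n g α :=
  Ideal.Quotient.mk (splitIdeal n g α) (MvPolynomial.X i)

/-- The reduced discriminant of `(f, α)`, where `f(u) = g(u²)`: the product of `α` and the
discriminant of `g`. -/
def reducedDiscr (g : A[X]) (α : A) : A := α * g.discr

/-- The `n + n(n-1)/2` elements `ηᵢ` and `ηᵢ² - ηⱼ²` (`i < j`) of the type D splitting ring. -/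
def degeneracy (n : ℕ) (g : A[X]) (α : A) :
    Fin n ⊕ {q : Fin n × Fin n // q.1 < q.2} → DSplit n g α
  | Sum.inl i => etaRoot n g α i
  | Sum.inr q => etaRoot n g α q.1.1 ^ 2 - etaRoot n g α q.1.2 ^ 2

/-- The locus in the spectrum of the type D splitting ring where at least two of the equations
`ηᵢ = 0`, `ηᵢ² = ηⱼ²` (`i < j`) hold. -/
def badLocusTop (n : ℕ) (g : A[X]) (α : A) : Set (PrimeSpectrum (DSplit n g α)) :=
  {x | ∃ s t, s ≠ t ∧ degeneracy n g α s ∈ x.asIdeal ∧ degeneracy n g α t ∈ x.asIdeal}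

/-- The bad locus in the spectrum of the base ring: the image of the bad locus upstairs. -/
def badLocus (n : ℕ) (g : A[X]) (α : A) : Set (PrimeSpectrum A) :=
  PrimeSpectrum.comap (algebraMap A (DSplit n g α)) '' badLocusTop n g α

end Splitting

end TypeD

end

/-!
A solution of the type D splitting problem for `(g(u²), α)` is the same as one root `x`, the product
`y` of the other roots, and a solution of the problem of rank one less for the quotient of `g` by
`v - x²` and for `y`. The pair `(x, y)` is parametrized by `A[X, Y] / (Y² - P(X), XY - α)`, where
the leading coefficient of `P` is `± 1`. This ring is free over `A`, so by induction the splitting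
ring `B` is flat over `A`.

Hence normality of `B` can be tested locally on `A` as in Serre's criterion. Over a prime `p` of
height at least two, the maximal ideal of `A_p` contains a regular sequence of length two, which
remains regular in `B` by flatness. Over a prime of height at most one, consider a local ring of
`B`. Outside the bad locus, at most one of the elements `ηᵢ`, `ηᵢ² - ηⱼ²` lies in its maximal ideal.
If there is one, call it `t`: it divides the reduced discriminant, hence, by squarefreeness, the
image of the maximal ideal of `A_p`. Modulo `t`, each `ηᵢ` is a simple root of `g(u²)`, of `g'(u²)`
or of `u`, so the quotient by `t` is unramified over `A_p`, and `t` generates the maximal ideal.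
If there is none, the same argument shows that a generator of the maximal ideal of `A_p` does.

For the second part, two coincidences among the roots over a prime of height one with uniformizer
`π` make the Sylvester matrix of `(g, g')` drop rank by two modulo `π`, or make both `α` and
the discriminant of `g` divisible by `π`. In either case `π²` divides the reduced discriminant.
-/

noncomputable section

namespace TypeD

open IsLocalRing nonZeroDivisors RingTheory.Sequence

/-! ### Serre's criterion -/

section Serre

open scoped Pointwise

/-- A local ring has a regular pair if its maximal ideal contains a regular sequence of length two,
that is, if its depth is at least two. -/
def HasRegularPair (R : Type*) [CommRing R] [IsLocalRing R] : Prop :=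
  ∃ a ∈ maximalIdeal R, ∃ b ∈ maximalIdeal R, IsWeaklyRegular R [a, b]

/-- The condition on a local ring `R_P` which, imposed at all primes `P` of a noetherian ring `R`,
makes `R` normal. It follows from Serre's conditions (R1) and (S2): the first alternative is to be
checked at primes of small height, the second one at all other primes. -/
def IsSerreLocal (R : Type*) [CommRing R] [IsLocalRing R] : Prop :=
  (IsDomain R ∧ IsIntegrallyClosed R) ∨ HasRegularPair R

theorem isWeaklyRegular_pair_iff {R : Type*} [CommRing R] {a b : R} :
    IsWeaklyRegular R [a, b] ↔ a ∈ R⁰ ∧ ∀ x, a ∣ b * x → a ∣ x := by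
  rw [isWeaklyRegular_cons_iff, isWeaklyRegular_singleton_iff,
    isSMulRegular_iff_right_eq_zero_of_smul, isSMulRegular_iff_right_eq_zero_of_smul,
    mem_nonZeroDivisors_iff_left]
  refine and_congr Iff.rfl ((Submodule.Quotient.mk_surjective _).forall.trans ?_)
  have mk_eq_zero_iff (x : R) :
      (Submodule.Quotient.mk x : R ⧸ a • (⊤ : Submodule R R)) = 0 ↔ a ∣ x := by
    rw [Submodule.Quotient.mk_eq_zero, Submodule.mem_smul_pointwise_iff_exists, dvd_def]
    simp only [Submodule.mem_top, true_and, smul_eq_mul, eq_comm]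
  simp only [← Submodule.Quotient.mk_smul, mk_eq_zero_iff, smul_eq_mul]

section LocalRing

variable {R S : Type*} [CommRing R] [IsLocalRing R] [CommRing S] [IsLocalRing S]

theorem HasRegularPair.of_flat [Algebra R S] [Module.Flat R S] [IsLocalHom (algebraMap R S)]
    (h : HasRegularPair R) : HasRegularPair S := by
  obtain ⟨a, ha, b, hb, hab⟩ := h
  exact ⟨_, map_mem_nonunits_iff (algebraMap R S) a |>.2 ha, _,
    map_mem_nonunits_iff (algebraMap R S) b |>.2 hb, by simpa using hab.of_flat (S := S)⟩

theorem IsSerreLocal.of_ringEquiv (e : R ≃+* S) (h : IsSerreLocal R) : IsSerreLocal S := by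
  rcases h with ⟨_, _⟩ | h
  · exact Or.inl ⟨e.symm.isDomain_iff.2 ‹_›, IsIntegrallyClosed.of_equiv e⟩
  · let := e.toRingHom.toAlgebra
    have : Module.Flat R S := RingHom.Flat.of_bijective e.bijective
    have : IsLocalHom (algebraMap R S) := isLocalHom_toRingHom e
    exact Or.inr h.of_flat

theorem HasRegularPair.dvd_of_forall_dvd_mul (h : HasRegularPair R) {s z : R} (hs : s ∈ R⁰)
    (hz : ∀ r ∈ maximalIdeal R, s ∣ r * z) : s ∣ z := by
  obtain ⟨a, ha, b, hb, hab⟩ := h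
  obtain ⟨ha_reg, hb_reg⟩ := isWeaklyRegular_pair_iff.1 hab
  obtain ⟨u, hu⟩ := hz a ha
  obtain ⟨v, hv⟩ := hz b hb
  have hbu : b * u = a * v :=
    (mul_cancel_left_mem_nonZeroDivisors hs).1 (by linear_combination (-b) * hu + a * hv)
  obtain ⟨w, rfl⟩ := hb_reg u ⟨v, hbu⟩
  exact ⟨w, (mul_cancel_left_mem_nonZeroDivisors ha_reg).1 (by linear_combination hu)⟩

theorem HasRegularPair.eq_zero_of_forall_mul_eq_zero (h : HasRegularPair R) {z : R}
    (hz : ∀ r ∈ maximalIdeal R, r * z = 0) : z = 0 := by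
  obtain ⟨a, ha, b, -, hab⟩ := h
  exact (mul_left_mem_nonZeroDivisors_eq_zero_iff (isWeaklyRegular_pair_iff.1 hab).1).1 (hz a ha)

theorem eq_zero_or_eq_one_of_isIdempotentElem {c : R} (hc : IsIdempotentElem c) :
    c = 0 ∨ c = 1 := by
  have hc' : c * (1 - c) = 0 := by linear_combination -hc.eq
  rcases isUnit_or_isUnit_one_sub_self c with hu | hu
  · exact Or.inr (sub_eq_zero.1 (hu.mul_right_eq_zero.1 hc')).symm
  · exact Or.inl (hu.mul_left_eq_zero.1 hc')

end LocalRing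

section Localization

variable {R : Type*} [CommRing R] (P : Ideal R) [P.IsPrime]

theorem not_dvd_localization {s z : R} (hP : ∀ r, s ∣ r * z → r ∈ P) :
    ¬ algebraMap R (Localization.AtPrime P) s ∣ algebraMap R (Localization.AtPrime P) z := by
  rintro ⟨x, hx⟩
  obtain ⟨r, t, rfl⟩ := IsLocalization.exists_mk'_eq P.primeCompl x
  have htz : algebraMap R (Localization.AtPrime P) (t * z) = algebraMap R _ (s * r) := by
    rw [map_mul, hx, map_mul, ← IsLocalization.mk'_spec (Localization.AtPrime P) r t]
    ring
  obtain ⟨c, hc⟩ := (IsLocalization.eq_iff_exists P.primeCompl _).1 htz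
  exact (c * t).2 (by simpa using hP (c * t) ⟨c * r, by linear_combination hc⟩)

theorem dvd_mul_of_mem_maximalIdeal {s z : R} (hP : ∀ r ∈ P, s ∣ r * z)
    (r : Localization.AtPrime P) (hr : r ∈ maximalIdeal (Localization.AtPrime P)) :
    algebraMap R (Localization.AtPrime P) s ∣ r * algebraMap R (Localization.AtPrime P) z := by
  suffices h : maximalIdeal (Localization.AtPrime P) ≤
      (Ideal.span {algebraMap R (Localization.AtPrime P) s}).colon
        {algebraMap R (Localization.AtPrime P) z} by
    simpa [Submodule.mem_colon_singleton, Ideal.mem_span_singleton] using h hr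
  rw [← Localization.AtPrime.map_eq_maximalIdeal, Ideal.map_le_iff_le_comap]
  intro x hx
  rw [Ideal.mem_comap, Submodule.mem_colon_singleton, smul_eq_mul, ← map_mul,
    Ideal.mem_span_singleton]
  exact map_dvd _ (hP x hx)

theorem map_dvd_map_of_isIntegral_mk' [IsIntegrallyClosed (Localization.AtPrime P)] {b : R}
    {s : R⁰} (h : IsIntegral R (IsLocalization.mk' (FractionRing R) b s)) :
    algebraMap R (Localization.AtPrime P) s ∣ algebraMap R (Localization.AtPrime P) b := by
  let K := FractionRing (Localization.AtPrime P)
  have hle : R⁰ ≤ (Localization.AtPrime P)⁰.comap (algebraMap R (Localization.AtPrime P)) :=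
    fun y hy ↦ IsLocalization.map_nonZeroDivisors_le P.primeCompl _ ⟨y, hy, rfl⟩
  have hintegral := h.map_of_comp_eq (algebraMap R (Localization.AtPrime P))
    (IsLocalization.map K (algebraMap R (Localization.AtPrime P)) hle : FractionRing R →+* K)
    (IsLocalization.map_comp hle).symm
  rw [IsLocalization.map_mk'] at hintegral
  obtain ⟨y, hy⟩ := IsIntegrallyClosed.algebraMap_eq_of_integral hintegral
  rw [eq_comm, IsLocalization.mk'_eq_iff_eq_mul, ← map_mul] at hy
  exact ⟨y, by rw [IsFractionRing.injective _ K hy, mul_comm]⟩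

end Localization

theorem exists_isIdempotentElem_mul_add_eq {R : Type*} [CommRing R] [IsIntegrallyClosed R] {x y : R}
    (hxy : x * y = 0) (hs : x + y ∈ R⁰) : ∃ c : R, IsIdempotentElem c ∧ c * (x + y) = x := by
  let q : FractionRing R := IsLocalization.mk' _ x ⟨x + y, hs⟩
  have hq : IsIdempotentElem q := by
    rw [IsIdempotentElem, ← IsLocalization.mk'_mul, IsLocalization.mk'_eq_iff_eq]
    congr 1
    simp only [Submonoid.coe_mul]
    linear_combination -(x + y) * hxy
  have hq_int : IsIntegral R q :=
    ⟨X ^ 2 - X, monic_X_pow_sub (by compute_degree!), by simp [pow_two, hq.eq]⟩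
  obtain ⟨c, hc⟩ := IsIntegrallyClosed.algebraMap_eq_of_integral hq_int
  refine ⟨c, ?_, ?_⟩ <;> apply IsFractionRing.injective R (FractionRing R)
  · rw [map_mul, hc, hq.eq]
  · rw [map_mul, hc]
    exact IsLocalization.mk'_spec _ _ _

section Noetherian

variable {R : Type*} [CommRing R]

theorem smul_mk_eq_zero_iff_dvd {a r b : R} :
    r • Ideal.Quotient.mk (Ideal.span {a}) b = 0 ↔ a ∣ r * b := by
  rw [Algebra.smul_def, Ideal.Quotient.algebraMap_eq, ← map_mul, Ideal.Quotient.eq_zero_iff_mem,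
    Ideal.mem_span_singleton]

theorem exists_isPrime_mem_iff_dvd [IsNoetherianRing R] {s b : R} (hb : ¬ s ∣ b) :
    ∃ (P : Ideal R) (_ : P.IsPrime) (c : R), ∀ r, r ∈ P ↔ s ∣ r * (c * b) := by
  let N : Submodule R (R ⧸ Ideal.span {s}) := R ∙ Ideal.Quotient.mk (Ideal.span {s}) b
  let x : N := ⟨Ideal.Quotient.mk _ b, Submodule.mem_span_singleton_self _⟩
  have hx : x ≠ 0 := by
    rwa [Ne, ← Subtype.val_inj, ZeroMemClass.coe_zero, Ideal.Quotient.eq_zero_iff_mem,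
      Ideal.mem_span_singleton]
  obtain ⟨P, hP, -⟩ := exists_le_isAssociatedPrime_of_isNoetherianRing R x hx
  rw [isAssociatedPrime_iff] at hP
  obtain ⟨hP, ⟨y, hy⟩, rfl⟩ := hP
  obtain ⟨c, rfl⟩ := Submodule.mem_span_singleton.1 hy
  refine ⟨_, hP, c, fun r ↦ ?_⟩
  rw [Submodule.mem_colon_singleton, Submodule.mem_bot, ← Subtype.val_inj]
  exact smul_mk_eq_zero_iff_dvd

variable [IsNoetherianRing R]

theorem exists_isPrime_localization_not_dvd {s b : R} (hb : ¬ s ∣ b) :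
    ∃ (P : Ideal R) (_ : P.IsPrime) (c : R),
      ¬ algebraMap R (Localization.AtPrime P) s ∣ algebraMap R (Localization.AtPrime P) (c * b) ∧
      ∀ r ∈ maximalIdeal (Localization.AtPrime P), algebraMap R (Localization.AtPrime P) s ∣
        r * algebraMap R (Localization.AtPrime P) (c * b) := by
  obtain ⟨P, hP, c, h⟩ := exists_isPrime_mem_iff_dvd hb
  exact ⟨P, hP, c, not_dvd_localization P fun r ↦ (h r).2,
    dvd_mul_of_mem_maximalIdeal P fun r ↦ (h r).1⟩

theorem isIntegrallyClosed_of_isSerreLocal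
    (h : ∀ (P : Ideal R) [P.IsPrime], IsSerreLocal (Localization.AtPrime P)) :
    IsIntegrallyClosed R := by
  rw [isIntegrallyClosed_iff (FractionRing R)]
  intro x hx
  obtain ⟨b, s, rfl⟩ := IsLocalization.exists_mk'_eq R⁰ x
  suffices hdvd : (s : R) ∣ b by
    obtain ⟨c, rfl⟩ := hdvd
    exact ⟨c, by rw [IsLocalization.mk'_mul_cancel_left]⟩
  by_contra hb
  obtain ⟨P, hP, c, hndvd, hdvd⟩ := exists_isPrime_localization_not_dvd hb
  refine hndvd ?_
  rcases h P with ⟨-, _⟩ | h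
  · rw [map_mul]
    exact (map_dvd_map_of_isIntegral_mk' P hx).mul_left _
  · exact h.dvd_of_forall_dvd_mul
      (IsLocalization.map_nonZeroDivisors_le P.primeCompl _ ⟨s, s.2, rfl⟩) hdvd

theorem isReduced_of_isSerreLocal
    (h : ∀ (P : Ideal R) [P.IsPrime], IsSerreLocal (Localization.AtPrime P)) : IsReduced R := by
  refine ⟨fun w hw ↦ ?_⟩
  by_contra hne
  obtain ⟨P, hP, c, hndvd, hdvd⟩ := exists_isPrime_localization_not_dvd (zero_dvd_iff.not.2 hne)
  simp only [map_zero, zero_dvd_iff] at hndvd hdvd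
  refine hndvd ?_
  rcases h P with ⟨_, -⟩ | h
  · rw [map_mul, (hw.map (algebraMap R (Localization.AtPrime P))).eq_zero, mul_zero]
  · exact h.eq_zero_of_forall_mul_eq_zero hdvd

theorem exists_add_mem_nonZeroDivisors_of_isReduced [IsReduced R] (I : Ideal R) :
    ∃ x ∈ I, ∃ y ∈ Module.annihilator R I, x + y ∈ R⁰ := by
  have : FaithfulSMul R (I ⊔ Module.annihilator R I : Ideal R) := by
    rw [← Module.annihilator_eq_bot, eq_bot_iff]
    intro z hz
    rw [Submodule.mem_annihilator] at hz
    have hzI : z ∈ Module.annihilator R I :=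
      Submodule.mem_annihilator.2 fun w hw ↦ hz w (Ideal.mem_sup_left hw)
    exact IsReduced.eq_zero z ⟨2, by rw [pow_two]; exact hz z (Ideal.mem_sup_right hzI)⟩
  obtain ⟨s, hs, hs_reg⟩ := Ideal.nonempty_inter_nonZeroDivisors_of_faithfulSMul
    (I := I ⊔ Module.annihilator R I)
  obtain ⟨x, hx, y, hy, rfl⟩ := Submodule.mem_sup.1 hs
  exact ⟨x, hx, y, hy, hs_reg⟩

theorem isDomain_of_isReduced_of_isIntegrallyClosed [IsLocalRing R] [IsReduced R]
    [IsIntegrallyClosed R] : IsDomain R := by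
  suffices NoZeroDivisors R from NoZeroDivisors.to_isDomain R
  refine ⟨fun {a b} hab ↦ ?_⟩
  obtain ⟨x, hx, y, hy, hs⟩ := exists_add_mem_nonZeroDivisors_of_isReduced (Ideal.span {a})
  rw [Submodule.mem_annihilator] at hy
  obtain ⟨c, hc, hcx⟩ := exists_isIdempotentElem_mul_add_eq (by rw [mul_comm]; exact hy x hx) hs
  rcases eq_zero_or_eq_one_of_isIdempotentElem hc with rfl | rfl
  · left
    have hx : x = 0 := by simpa using hcx.symm
    rw [hx, zero_add] at hs
    exact (mul_left_mem_nonZeroDivisors_eq_zero_iff hs).1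
      (hy a (Ideal.mem_span_singleton_self a))
  · right
    obtain ⟨r, rfl⟩ := Ideal.mem_span_singleton.1 hx
    rw [← one_mul (a * r + y), hcx] at hs
    exact (mul_left_mem_nonZeroDivisors_eq_zero_iff hs).1 (by linear_combination r * hab)

theorem isNormalRing_of_isSerreLocal
    (h : ∀ (P : Ideal R) [P.IsPrime], IsSerreLocal (Localization.AtPrime P)) :
    IsNormalRing R := by
  have isSerreLocal_localization (x : PrimeSpectrum R)
      (P : Ideal (Localization.AtPrime x.asIdeal)) [P.IsPrime] :
      IsSerreLocal (Localization.AtPrime P) :=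
    (h (P.comap (algebraMap R _))).of_ringEquiv
      (IsLocalization.localizationLocalizationAtPrimeIsoLocalization
        x.asIdeal.primeCompl P).toRingEquiv
  have isNoetherianRing_localization (x : PrimeSpectrum R) :
      IsNoetherianRing (Localization.AtPrime x.asIdeal) :=
    IsLocalization.isNoetherianRing x.asIdeal.primeCompl _ inferInstance
  have isIntegrallyClosed_localization (x : PrimeSpectrum R) :
      IsIntegrallyClosed (Localization.AtPrime x.asIdeal) :=
    isIntegrallyClosed_of_isSerreLocal (isSerreLocal_localization x)
  refine ⟨fun x ↦ ?_, isIntegrallyClosed_localization⟩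
  have := isReduced_of_isSerreLocal (isSerreLocal_localization x)
  exact isDomain_of_isReduced_of_isIntegrallyClosed

end Noetherian

end Serre

section RegularPair

variable {R : Type*} [CommRing R] [IsDomain R] [IsIntegrallyClosed R]

theorem dvd_of_forall_exists_mul_eq_mul {I : Ideal R} (hI : I.FG) (hI₀ : I ≠ ⊥) {a b : R}
    (ha : a ≠ 0) (h : ∀ m ∈ I, ∃ k ∈ I, b * m = a * k) : a ∣ b := by
  let K := FractionRing R
  have ha' : algebraMap R K a ≠ 0 := IsFractionRing.to_map_eq_zero_iff.not.2 ha
  let M := Submodule.map (Algebra.linearMap R K) I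
  have hM₀ : M ≠ ⊥ := fun hM ↦ hI₀ <|
    Submodule.map_injective_of_injective (f := Algebra.linearMap R K) (IsFractionRing.injective R K)
      (hM.trans (Submodule.map_bot _).symm)
  have hintegral : IsIntegral R (algebraMap R K b / algebraMap R K a) := by
    refine isIntegral_of_smul_mem_submodule M hM₀ (Submodule.FG.map _ hI) _ ?_
    rintro _ ⟨m, hm, rfl⟩
    obtain ⟨k, hk, hmk⟩ := h m hm
    refine ⟨k, hk, ?_⟩
    rw [Algebra.linearMap_apply, Algebra.linearMap_apply, smul_eq_mul, div_mul_eq_mul_div,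
      ← map_mul, hmk, map_mul, mul_div_cancel_left₀ _ ha']
  obtain ⟨y, hy⟩ := IsIntegrallyClosed.algebraMap_eq_of_integral hintegral
  refine ⟨y, IsFractionRing.injective R K ?_⟩
  rw [map_mul, hy, mul_div_cancel₀ _ ha']

variable [IsLocalRing R] [IsNoetherianRing R]

theorem isPrincipal_maximalIdeal_of_forall_dvd_mul {a b : R} (ha : a ≠ 0) (hb : ¬ a ∣ b)
    (h : ∀ m ∈ maximalIdeal R, a ∣ b * m) : (maximalIdeal R).IsPrincipal := by
  by_cases hbot : maximalIdeal R = ⊥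
  · rw [hbot]; exact bot_isPrincipal
  obtain ⟨m, hm, k, hk, hmk⟩ : ∃ m ∈ maximalIdeal R, ∃ k, IsUnit k ∧ b * m = a * k := by
    by_contra! hno
    refine hb (dvd_of_forall_exists_mul_eq_mul (IsNoetherian.noetherian _) hbot ha fun m hm ↦ ?_)
    obtain ⟨k, hk⟩ := h m hm
    exact ⟨k, fun hku ↦ hno m hm k hku hk, hk⟩
  have hb₀ : b ≠ 0 := by
    rintro rfl
    exact hb (dvd_zero a)
  refine ⟨m, le_antisymm (fun z hz ↦ ?_) ((Ideal.span_singleton_le_iff_mem _).2 hm)⟩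
  obtain ⟨l, hl⟩ := h z hz
  rw [Ideal.submodule_span_eq, Ideal.mem_span_singleton, ← hk.dvd_mul_right]
  exact ⟨l, mul_left_cancel₀ hb₀ (by linear_combination k * hl - l * hmk)⟩

theorem maximalIdeal_notMem_associatedPrimes {a : R} (ha : a ≠ 0)
    (h : ¬ (maximalIdeal R).IsPrincipal) :
    maximalIdeal R ∉ associatedPrimes R (R ⧸ Ideal.span {a}) := by
  intro hmem
  rw [AssociatedPrimes.mem_iff, isAssociatedPrime_iff] at hmem
  obtain ⟨-, y, hy⟩ := hmem
  obtain ⟨b, rfl⟩ := Ideal.Quotient.mk_surjective y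
  have mem_iff (r : R) : r ∈ maximalIdeal R ↔ a ∣ b * r := by
    rw [hy, Submodule.mem_colon_singleton, Submodule.mem_bot, smul_mk_eq_zero_iff_dvd, mul_comm]
  refine h (isPrincipal_maximalIdeal_of_forall_dvd_mul ha ?_ fun m ↦ (mem_iff m).1)
  rw [← mul_one b, ← mem_iff]
  exact one_notMem_nonunits

theorem hasRegularPair_of_not_isPrincipal (h : ¬ (maximalIdeal R).IsPrincipal) :
    HasRegularPair R := by
  obtain ⟨a, ha, ha₀⟩ : ∃ a ∈ maximalIdeal R, a ≠ 0 :=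
    Submodule.exists_mem_ne_zero_of_ne_bot fun hbot ↦ h (hbot ▸ bot_isPrincipal)
  obtain ⟨b, hb, hb'⟩ : ∃ b ∈ maximalIdeal R,
      b ∉ ⋃ P ∈ associatedPrimes R (R ⧸ Ideal.span {a}), (P : Set R) := by
    refine Set.not_subset.1 fun hsub ↦ maximalIdeal_notMem_associatedPrimes ha₀ h ?_
    obtain ⟨P, hP, hle⟩ := (Ideal.subset_union_prime_finite
      (associatedPrimes.finite R (R ⧸ Ideal.span {a})) (f := id) 0 0
      fun _ hP _ _ ↦ IsAssociatedPrime.isPrime hP).1 hsub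
    rwa [((maximalIdeal.isMaximal R).eq_of_le (IsAssociatedPrime.isPrime hP).ne_top hle)]
  rw [biUnion_associatedPrimes_eq_zero_divisors] at hb'
  refine ⟨a, ha, b, hb, isWeaklyRegular_pair_iff.2
    ⟨mem_nonZeroDivisors_of_ne_zero ha₀, fun x hx ↦ ?_⟩⟩
  by_contra hax
  refine hb' ⟨Ideal.Quotient.mk _ x, ?_, smul_mk_eq_zero_iff_dvd.2 hx⟩
  rwa [Ne, Ideal.Quotient.eq_zero_iff_mem, Ideal.mem_span_singleton]

theorem hasRegularPair_of_two_le_height (h : 2 ≤ (maximalIdeal R).height) : HasRegularPair R := by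
  refine hasRegularPair_of_not_isPrincipal fun _ ↦ ?_
  have hle := Ideal.height_le_one_of_isPrincipal_of_mem_minimalPrimes (maximalIdeal R)
    (maximalIdeal R) (by simp [Ideal.minimalPrimes_eq_subsingleton_self])
  exact absurd (h.trans hle) (by norm_num)

end RegularPair

theorem isNormalRing_of_flat {A B : Type*} [CommRing A] [IsNoetherianRing A] [IsNormalRing A]
    [CommRing B] [IsNoetherianRing B] [Algebra A B] [Module.Flat A B]
    (h : ∀ (q : Ideal B) [q.IsPrime], (q.under A).height ≤ 1 →
      IsDomain (Localization.AtPrime q) ∧ IsIntegrallyClosed (Localization.AtPrime q)) :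
    IsNormalRing B := by
  refine isNormalRing_of_isSerreLocal fun q _ ↦ ?_
  rcases le_or_gt (q.under A).height 1 with hq | hq
  · exact Or.inl (h q hq)
  · right
    let p := q.under A
    let := Localization.AtPrime.algebraOfLiesOver p q
    have : IsDomain (Localization.AtPrime p) :=
      IsNormalRing.isDomain_localization ⟨p, inferInstance⟩
    have : IsIntegrallyClosed (Localization.AtPrime p) :=
      IsNormalRing.isIntegrallyClosed_localization ⟨p, inferInstance⟩
    have : IsNoetherianRing (Localization.AtPrime p) :=
      IsLocalization.isNoetherianRing p.primeCompl _ inferInstance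
    have : IsLocalHom (algebraMap (Localization.AtPrime p) (Localization.AtPrime q)) :=
      Localization.isLocalHom_localRingHom p q _ _
    refine HasRegularPair.of_flat (R := Localization.AtPrime p)
      (hasRegularPair_of_two_le_height ?_)
    rw [← IsLocalization.height_under p.primeCompl, Localization.AtPrime.under_maximalIdeal]
    exact Order.add_one_le_of_lt hq

/-! ### The ring generated by one root and the product of the others -/

section Quadric

variable {A : Type*} [CommRing A]

/-- The ideal of `A[X][Y]` generated by `Y² - P(X)` and `XY - α`. -/
def quadricIdeal (P : A[X]) (α : A) : Ideal A[X][X] :=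
  Ideal.span {X ^ 2 - C P, C X * X - C (C α)}

/-- The ring `A[X, Y] / (Y² - P(X), XY - α)`. For a suitable `P` it is generated over `A` by a root
`x` of the type D splitting problem and the product `y` of all the other roots. -/
def Quadric (P : A[X]) (α : A) : Type _ := A[X][X] ⧸ quadricIdeal P α

namespace Quadric

variable (P : A[X]) (α : A)

instance : CommRing (Quadric P α) := inferInstanceAs (CommRing (A[X][X] ⧸ quadricIdeal P α))

instance : Algebra A (Quadric P α) := inferInstanceAs (Algebra A (A[X][X] ⧸ quadricIdeal P α))

/-- The quotient map onto `A[X, Y] / (Y² - P(X), XY - α)`. -/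
def mk : A[X][X] →ₐ[A] Quadric P α := Ideal.Quotient.mkₐ A (quadricIdeal P α)

/-- The class of `X` in `A[X, Y] / (Y² - P(X), XY - α)`. -/
def x : Quadric P α := mk P α (C X)

/-- The class of `Y` in `A[X, Y] / (Y² - P(X), XY - α)`. -/
def y : Quadric P α := mk P α X

theorem mk_surjective : Function.Surjective (mk P α) := Ideal.Quotient.mk_surjective

theorem mk_eq_zero_iff (z : A[X][X]) : mk P α z = 0 ↔ z ∈ quadricIdeal P α :=
  Ideal.Quotient.eq_zero_iff_mem

theorem mk_C (p : A[X]) : mk P α (C p) = aeval (x P α) p := by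
  have h : (mk P α).comp CAlgHom = aeval (x P α) := Polynomial.algHom_ext (by simp [x])
  exact DFunLike.congr_fun h p

theorem y_sq : y P α ^ 2 = aeval (x P α) P := by
  rw [← mk_C, y, ← map_pow, ← sub_eq_zero, ← map_sub, mk_eq_zero_iff]
  exact Ideal.subset_span (by simp)

theorem x_mul_y : x P α * y P α = algebraMap A _ α := by
  rw [← aeval_C (x P α) α, ← mk_C, x, y, ← map_mul, ← sub_eq_zero, ← map_sub, mk_eq_zero_iff]
  exact Ideal.subset_span (by simp)

variable {P α}

/-- The universal property of `A[X, Y] / (Y² - P(X), XY - α)`. -/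
def lift {S : Type*} [CommRing S] [Algebra A S] (a b : S) (hb : b ^ 2 = aeval a P)
    (hab : a * b = algebraMap A S α) : Quadric P α →ₐ[A] S :=
  Ideal.Quotient.liftₐ (quadricIdeal P α) (aevalTower (aeval a) b) (by
    suffices quadricIdeal P α ≤ RingHom.ker (aevalTower (aeval a) b : A[X][X] →ₐ[A] S) from
      fun z hz ↦ this hz
    rw [quadricIdeal, Ideal.span_le]
    rintro _ (rfl | rfl)
    · simp [RingHom.mem_ker, hb]
    · simp [RingHom.mem_ker, hab])

section

variable {S : Type*} [CommRing S] [Algebra A S] (a b : S) (hb : b ^ 2 = aeval a P)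
  (hab : a * b = algebraMap A S α)

theorem lift_x : lift a b hb hab (x P α) = a :=
  (Ideal.Quotient.lift_mk (quadricIdeal P α) _ _).trans (by simp)

theorem lift_y : lift a b hb hab (y P α) = b :=
  (Ideal.Quotient.lift_mk (quadricIdeal P α) _ _).trans (by simp)

end

theorem exists_C_mul_X_add_C_eq_modByMonic [Nontrivial A] (z : A[X][X]) :
    ∃ t s, z %ₘ (X ^ 2 - C P) = C t * X + C s := by
  have hdeg := degree_modByMonic_lt z (monic_X_pow_sub_C P two_ne_zero)
  rw [degree_X_pow_sub_C two_pos] at hdeg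
  exact exists_eq_X_add_C_of_natDegree_le_one
    (natDegree_le_of_degree_le (Order.le_of_lt_succ hdeg))

theorem exists_eq_of_mem_quadricIdeal [Nontrivial A] {r q : A[X]}
    (h : C r + C q * X ∈ quadricIdeal P α) :
    ∃ s t, r = X * P * t - C α * s ∧ q = X * s - C α * t := by
  obtain ⟨u, v, huv⟩ := Ideal.mem_span_pair.1 h
  have hmonic : (X ^ 2 - C P : A[X][X]).Monic := monic_X_pow_sub_C P two_ne_zero
  obtain ⟨t, s, hts⟩ := exists_C_mul_X_add_C_eq_modByMonic (P := P) v
  have hdvd : (X ^ 2 - C P) ∣ C (q - (X * s - C α * t)) * X + C (r - (X * P * t - C α * s)) := by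
    refine ⟨u + (v /ₘ (X ^ 2 - C P)) * (C X * X - C (C α)) + C (X * t), ?_⟩
    rw [← modByMonic_add_div v (X ^ 2 - C P), hts] at huv
    simp only [map_sub, map_mul]
    linear_combination -huv
  have hzero := by_contra fun hne ↦ hmonic.not_dvd_of_degree_lt hne
    (by rw [degree_X_pow_sub_C two_pos]; exact degree_linear_lt) hdvd
  refine ⟨s, t, ?_, ?_⟩
  · simpa [sub_eq_zero] using congrArg (coeff · 0) hzero
  · simpa [sub_eq_zero] using congrArg (coeff · 1) hzero

variable (P α) in
/-- The linear combinations of `1, x, …, x^d, y`, where `d` is the degree of `P`. -/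
def coordMap : degreeLT A (P.natDegree + 1) × A →ₗ[A] Quadric P α :=
  ((aeval (x P α)).toLinearMap ∘ₗ (degreeLT A (P.natDegree + 1)).subtype).coprod
    (LinearMap.toSpanSingleton A (Quadric P α) (y P α))

theorem coordMap_apply (r : degreeLT A (P.natDegree + 1)) (c : A) :
    coordMap P α (r, c) = aeval (x P α) (r : A[X]) + c • y P α := by
  simp [coordMap]

theorem aeval_mul_y (q : A[X]) :
    aeval (x P α) q * y P α = α • aeval (x P α) q.divX + q.coeff 0 • y P α := by
  conv_lhs => rw [← divX_mul_X_add q]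
  simp only [map_add, map_mul, aeval_X, aeval_C, Algebra.smul_def, ← x_mul_y]
  ring

theorem exists_eq_aeval_add_smul_y [Nontrivial A] (z : Quadric P α) :
    ∃ (p : A[X]) (c : A), z = aeval (x P α) p + c • y P α := by
  obtain ⟨z, rfl⟩ := mk_surjective P α z
  obtain ⟨q, p, hqp⟩ := exists_C_mul_X_add_C_eq_modByMonic (P := P) z
  refine ⟨p + C α * q.divX, q.coeff 0, ?_⟩
  have hmk : mk P α (X ^ 2 - C P) = 0 := by
    rw [map_sub, mk_C, map_pow, ← y_sq]
    exact sub_self _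
  rw [← modByMonic_add_div z (X ^ 2 - C P), hqp, map_add, map_mul, hmk, zero_mul, add_zero, map_add,
    map_mul, mk_C, mk_C, map_add, map_mul, aeval_C, ← Algebra.smul_def, add_assoc, ← aeval_mul_y,
    add_comm]
  rfl

theorem aeval_X_mul_self : aeval (x P α) (X * P) = α • y P α := by
  rw [map_mul, aeval_X, ← y_sq, pow_two, ← mul_assoc, x_mul_y, Algebra.smul_def]

theorem exists_eq_add_X_mul_self_mul [Nontrivial A] (hP : IsUnit P.leadingCoeff) (p : A[X]) :
    ∃ r k, p = r + X * P * k ∧ r.degree < ((P.natDegree + 1 : ℕ) : WithBot ℕ) ∧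
      k.natDegree ≤ p.natDegree - (P.natDegree + 1) := by
  obtain ⟨u, hu⟩ := hP.exists_right_inv
  have hXP : (X * P * C u).Monic := by
    rw [mul_assoc]
    exact monic_X.mul (monic_mul_C_of_leadingCoeff_mul_eq_one hu)
  have hdeg : (X * P * C u).natDegree = P.natDegree + 1 := by
    have hne : P ≠ 0 := by rintro rfl; simp at hu
    rw [natDegree_mul_C_eq_of_mul_eq_one (by rwa [mul_comm]), natDegree_X_mul hne]
  refine ⟨p %ₘ (X * P * C u), C u * (p /ₘ (X * P * C u)), ?_, ?_, ?_⟩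
  · rw [← mul_assoc, modByMonic_add_div]
  · rw [← hdeg, ← degree_eq_natDegree hXP.ne_zero]
    exact degree_modByMonic_lt p hXP
  · rw [← hdeg, ← natDegree_divByMonic p hXP]
    exact natDegree_C_mul_le _ _

theorem aeval_mem_range_coordMap [Nontrivial A] (hP : IsUnit P.leadingCoeff) (p : A[X]) :
    aeval (x P α) p ∈ LinearMap.range (coordMap P α) := by
  have hlow : ∀ r : A[X], r.degree < ((P.natDegree + 1 : ℕ) : WithBot ℕ) → ∀ c : A,
      aeval (x P α) r + c • y P α ∈ LinearMap.range (coordMap P α) := fun r hr c ↦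
    ⟨(⟨r, mem_degreeLT.2 hr⟩, c), coordMap_apply _ _⟩
  induction h : p.natDegree using Nat.strong_induction_on generalizing p with
  | h N ih =>
    obtain hN | hN := lt_or_ge N (P.natDegree + 1)
    · simpa using hlow p (degree_le_natDegree.trans_lt (by exact_mod_cast h.trans_lt hN)) 0
    obtain ⟨r, k, hp, hr, hk⟩ := exists_eq_add_X_mul_self_mul hP p
    have heq : aeval (x P α) p = (aeval (x P α) r + (α * k.coeff 0) • y P α) +
        (α * α) • aeval (x P α) k.divX := by
      rw [hp, map_add, map_mul, aeval_X_mul_self, smul_mul_assoc, mul_comm (y P α), aeval_mul_y]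
      module
    rw [heq]
    refine add_mem (hlow r hr _) (Submodule.smul_mem _ _ (ih _ ?_ _ rfl))
    rw [natDegree_divX_eq_natDegree_tsub_one]
    lia

theorem coordMap_surjective [Nontrivial A] (hP : IsUnit P.leadingCoeff) :
    Function.Surjective (coordMap P α) := by
  intro z
  obtain ⟨p, c, rfl⟩ := exists_eq_aeval_add_smul_y z
  obtain ⟨w, hw⟩ := aeval_mem_range_coordMap hP p
  exact ⟨w + (0, c), by rw [map_add, hw, coordMap_apply]; simp⟩

theorem eq_zero_of_degree_mul_lt {N t : A[X]} (hN : IsUnit N.leadingCoeff)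
    (h : (N * t).degree < N.natDegree) : t = 0 := by
  by_contra ht
  have hne : N.leadingCoeff * t.leadingCoeff ≠ 0 := by
    rwa [Ne, hN.mul_right_eq_zero, leadingCoeff_eq_zero]
  have hN0 : N ≠ 0 := by rintro rfl; simp at hne
  rw [degree_mul' hne, degree_eq_natDegree hN0, degree_eq_natDegree ht] at h
  norm_cast at h
  lia

theorem natDegree_X_sq_mul_sub_C [Nontrivial A] (hP : IsUnit P.leadingCoeff) (c : A) :
    (X ^ 2 * P - C c).natDegree = P.natDegree + 2 ∧
      (X ^ 2 * P - C c).leadingCoeff = P.leadingCoeff := by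
  have hne : P ≠ 0 := by rintro rfl; simp at hP
  have hdeg : (X ^ 2 * P - C c).natDegree = P.natDegree + 2 := by
    rw [natDegree_sub_C, natDegree_X_pow_mul 2 hne]
  refine ⟨hdeg, ?_⟩
  rw [leadingCoeff, hdeg, coeff_sub, coeff_X_pow_mul, coeff_C_of_ne_zero (by lia), sub_zero,
    coeff_natDegree]

theorem coordMap_injective [Nontrivial A] (hP : IsUnit P.leadingCoeff) :
    Function.Injective (coordMap P α) := by
  rw [injective_iff_map_eq_zero]
  rintro ⟨⟨r, hr⟩, c⟩ h
  rw [mem_degreeLT] at hr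
  have hmem : C r + C (C c) * X ∈ quadricIdeal P α := by
    rw [← mk_eq_zero_iff, ← h, coordMap_apply, map_add, mk_C, map_mul, mk_C, aeval_C,
      Algebra.smul_def]
    rfl
  obtain ⟨s, t, hrst, hc⟩ := exists_eq_of_mem_quadricIdeal hmem
  obtain ⟨hdeg, hlead⟩ := natDegree_X_sq_mul_sub_C hP (α ^ 2)
  obtain rfl : t = 0 := by
    refine eq_zero_of_degree_mul_lt (hlead ▸ hP) ?_
    have hmul : (X ^ 2 * P - C (α ^ 2)) * t = X * r + C (α * c) := by
      rw [hrst]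
      simp only [C_mul, C_pow, hc]
      ring
    rw [hmul, hdeg, degree_lt_iff_coeff_zero]
    rintro (_ | k) hk
    · lia
    · rw [coeff_add, coeff_X_mul, coeff_C_succ, (degree_lt_iff_coeff_zero _ _).1 hr k (by lia),
        add_zero]
  obtain rfl : c = 0 := by simpa using congrArg (coeff · 0) hc
  obtain rfl : s = 0 := monic_X.mul_right_eq_zero_iff.1 (by simpa using hc.symm)
  simpa using hrst

theorem free (hP : IsUnit P.leadingCoeff) : Module.Free A (Quadric P α) := by
  cases subsingleton_or_nontrivial A
  · exact Module.Free.of_subsingleton' A _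
  have : Module.Free A (degreeLT A (P.natDegree + 1)) :=
    Module.Free.of_basis (degreeLT.basis A (P.natDegree + 1))
  exact Module.Free.of_equiv (LinearEquiv.ofBijective (coordMap P α)
    ⟨coordMap_injective hP, coordMap_surjective hP⟩)

end Quadric

end Quadric

/-! ### The universal property of the splitting ring -/

section Universal

variable {A S : Type*} [CommRing A] [CommRing S] [Algebra A S] {n : ℕ} {g : A[X]} {α : A}
  {e : Fin n → S}

/-- The elements `eᵢ` of an `A`-algebra solve the type D splitting problem for `(g(u²), α)`:
`g(v) = ∏ᵢ (v - eᵢ²)` and `∏ᵢ eᵢ = α`. -/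
structure IsTypeDRoots (g : A[X]) (α : A) (e : Fin n → S) : Prop where
  map_eq : g.map (algebraMap A S) = ∏ i, (X - C (e i ^ 2))
  prod_eq : ∏ i, e i = algebraMap A S α

theorem IsTypeDRoots.map {T : Type*} [CommRing T] [Algebra A T] (h : IsTypeDRoots g α e)
    (ψ : S →ₐ[A] T) : IsTypeDRoots g α (fun i ↦ ψ (e i)) where
  map_eq := by
    rw [← ψ.comp_algebraMap, ← Polynomial.map_map, h.map_eq, Polynomial.map_prod]
    simp
  prod_eq := by rw [← map_prod, h.prod_eq, ψ.commutes]

theorem map_splitDiff (n : ℕ) (g : A[X]) (e : Fin n → S) :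
    (splitDiff n g).map (MvPolynomial.aeval e : MvPolynomial (Fin n) A →ₐ[A] S).toRingHom =
      expand S 2 (g.map (algebraMap A S) - ∏ i, (X - C (e i ^ 2))) := by
  have h : (MvPolynomial.aeval e : MvPolynomial (Fin n) A →ₐ[A] S).toRingHom.comp
      MvPolynomial.C = algebraMap A S := (MvPolynomial.aeval e).comp_algebraMap
  simp only [splitDiff, Polynomial.map_sub, map_expand, Polynomial.map_map, h,
    Polynomial.map_prod, map_sub, map_prod]
  simp

variable (n g α) in
theorem isTypeDRoots_etaRoot : IsTypeDRoots g α (etaRoot n g α) := by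
  have hmk : Ideal.Quotient.mkₐ A (splitIdeal n g α) = MvPolynomial.aeval (etaRoot n g α) :=
    MvPolynomial.algHom_ext fun i ↦ (MvPolynomial.aeval_X (etaRoot n g α) i).symm
  constructor
  · rw [← sub_eq_zero]
    apply expand_injective (R := DSplit n g α) two_pos
    rw [← map_splitDiff, ← hmk, map_zero]
    ext k
    rw [coeff_map, coeff_zero]
    exact Ideal.Quotient.eq_zero_iff_mem.2 (Ideal.subset_span (Or.inl ⟨k, rfl⟩))
  · have hmem : ∏ i : Fin n, MvPolynomial.X i - MvPolynomial.C α ∈ splitIdeal n g α :=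
      Ideal.subset_span (Or.inr rfl)
    rw [← Ideal.Quotient.eq_zero_iff_mem, map_sub, map_prod, sub_eq_zero] at hmem
    exact hmem

/-- The universal property of the type D splitting ring. -/
def DSplit.lift (h : IsTypeDRoots g α e) : DSplit n g α →ₐ[A] S :=
  Ideal.Quotient.liftₐ (splitIdeal n g α) (MvPolynomial.aeval e) (by
    suffices splitIdeal n g α ≤ RingHom.ker (MvPolynomial.aeval e : MvPolynomial (Fin n) A →ₐ[A] S)
      from fun z hz ↦ this hz
    rw [splitIdeal, Ideal.span_le]
    rintro _ (⟨k, rfl⟩ | rfl)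
    · have hzero := map_splitDiff n g e
      rw [h.map_eq, sub_self, map_zero] at hzero
      simpa using congrArg (coeff · k) hzero
    · simp [RingHom.mem_ker, h.prod_eq])

theorem DSplit.lift_etaRoot (h : IsTypeDRoots g α e) (i : Fin n) :
    DSplit.lift h (etaRoot n g α i) = e i :=
  (Ideal.Quotient.lift_mk (splitIdeal n g α) _ _).trans (MvPolynomial.aeval_X e i)

theorem DSplit.algHom_ext {f f' : DSplit n g α →ₐ[A] S}
    (h : ∀ i, f (etaRoot n g α i) = f' (etaRoot n g α i)) : f = f' :=
  Ideal.Quotient.algHom_ext A (MvPolynomial.algHom_ext h)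

end Universal

/-! ### Flatness of the splitting ring -/

section Flat

variable {A : Type*} [CommRing A] {m : ℕ} {g : A[X]} {α : A}

theorem isTypeDRoots_zero {S : Type*} [CommRing S] [Algebra A S] (h : algebraMap A S α = 1) :
    IsTypeDRoots 1 α (Fin.elim0 : Fin 0 → S) where
  map_eq := by simp
  prod_eq := by simp [h]

-- As `α² = 1` and `2` is invertible, `DSplit 0 1 α = A / (α - 1)` is `A` localized at `1 + α`.
theorem flat_dSplit_zero (h2 : IsUnit (2 : A)) (hα : α ^ 2 = 1) :
    Module.Flat A (DSplit 0 1 α) := by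
  have hαB : algebraMap A (DSplit 0 1 α) α = 1 := by
    simpa using (isTypeDRoots_etaRoot 0 1 α).prod_eq.symm
  have hαL : algebraMap A (Localization.Away (1 + α)) α = 1 := by
    have hunit := IsLocalization.Away.algebraMap_isUnit (S := Localization.Away (1 + α)) (1 + α)
    have hzero := congrArg (algebraMap A (Localization.Away (1 + α)))
      (show (1 + α) * (α - 1) = 0 by linear_combination hα)
    rwa [map_mul, map_zero, hunit.mul_right_eq_zero, map_sub, map_one, sub_eq_zero] at hzero
  have hunit : ∀ y : Submonoid.powers (1 + α), IsUnit (Algebra.ofId A (DSplit 0 1 α) y) := by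
    rintro ⟨_, k, rfl⟩
    have htwo := (h2.map (algebraMap A (DSplit 0 1 α))).pow k
    rw [map_ofNat] at htwo
    simpa [Algebra.ofId_apply, hαB, one_add_one_eq_two] using htwo
  let toAway : DSplit 0 1 α →ₐ[A] Localization.Away (1 + α) :=
    DSplit.lift (isTypeDRoots_zero hαL)
  let ofAway : Localization.Away (1 + α) →ₐ[A] DSplit 0 1 α := IsLocalization.liftAlgHom hunit
  have : Module.Flat A (Localization.Away (1 + α)) :=
    IsLocalization.flat _ (Submonoid.powers (1 + α))
  refine Module.Flat.of_retract toAway.toLinearMap ofAway.toLinearMap ?_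
  exact congrArg AlgHom.toLinearMap
    (DSplit.algHom_ext fun i ↦ i.elim0 : ofAway.comp toAway = AlgHom.id A _)

theorem eval_divX_X_sub_C_mul (w : A) (k : A[X]) :
    ((X - C w) * k).divX.eval w = k.coeff 0 := by
  have hdivX : ((X - C w) * k).divX = k - C w * k.divX := by
    ext j
    simp [coeff_divX, sub_mul]
  have heval := congrArg (eval w) (X_mul_divX_add k)
  simp only [eval_add, eval_mul, eval_X, eval_C] at heval
  rw [hdivX, eval_sub, eval_mul, eval_C]
  linear_combination -heval

theorem divX_map {S : Type*} [CommRing S] (φ : A →+* S) (p : A[X]) :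
    (p.map φ).divX = p.divX.map φ := by
  ext k
  simp [coeff_divX]

theorem coeff_zero_prod_X_sub_C_sq (e : Fin m → A) :
    (∏ i, (X - C (e i ^ 2)) : A[X]).coeff 0 = (-1) ^ m * (∏ i, e i) ^ 2 := by
  rw [coeff_zero_eq_eval_zero, eval_prod]
  simp [Finset.prod_neg, Finset.prod_pow]

/-- The polynomial `± (g(X²) - g(0)) / X²`: its value at a root of the type D splitting problem for
`g(u²)` is the square of the product of the other `m` roots. -/
def residualPoly (m : ℕ) (g : A[X]) : A[X] := C ((-1) ^ m) * expand A 2 g.divX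

/-- The quotient of `g` by `v - x²`, over the ring generated by a first root `x` and the product `y`
of the other roots. -/
def residualFactor (m : ℕ) (g : A[X]) (α : A) : (Quadric (residualPoly m g) α)[X] :=
  g.map (algebraMap A _) /ₘ (X - C (Quadric.x (residualPoly m g) α ^ 2))

theorem isUnit_leadingCoeff_residualPoly (hg : g.Monic) (hgn : g.natDegree = m + 1) :
    IsUnit (residualPoly m g).leadingCoeff := by
  have hdivX : g.divX.Monic := by
    rw [Monic, leadingCoeff, natDegree_divX_eq_natDegree_tsub_one, coeff_divX, hgn,
      add_tsub_cancel_right, ← hgn]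
    exact hg
  rw [residualPoly, leadingCoeff_mul_monic (hdivX.expand two_pos), leadingCoeff_C]
  exact isUnit_one.neg.pow m

theorem aeval_residualPoly {S : Type*} [CommRing S] [Algebra A S] (a : S) :
    aeval a (residualPoly m g) = (-1) ^ m * (g.map (algebraMap A S)).divX.eval (a ^ 2) := by
  simp [residualPoly, expand_aeval, divX_map]

theorem isRoot_map_x_sq (hα : α ^ 2 = (-1) ^ (m + 1) * g.coeff 0) :
    (g.map (algebraMap A (Quadric (residualPoly m g) α))).IsRoot
      (Quadric.x (residualPoly m g) α ^ 2) := by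
  have hy := Quadric.y_sq (residualPoly m g) α
  have hxy := Quadric.x_mul_y (residualPoly m g) α
  have hα' := congrArg (algebraMap A (Quadric (residualPoly m g) α)) hα
  rw [aeval_residualPoly] at hy
  simp only [map_pow, map_mul, map_neg, map_one] at hα'
  rw [IsRoot, ← X_mul_divX_add (g.map _), eval_add, eval_mul, eval_X, eval_C, coeff_map,
    ← (isUnit_one.neg.pow m).mul_right_eq_zero]
  linear_combination hα' - Quadric.x (residualPoly m g) α ^ 2 * hy +
    (Quadric.x (residualPoly m g) α * Quadric.y (residualPoly m g) α + algebraMap A _ α) * hxy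

theorem X_sub_C_mul_residualFactor (hα : α ^ 2 = (-1) ^ (m + 1) * g.coeff 0) :
    (X - C (Quadric.x (residualPoly m g) α ^ 2)) * residualFactor m g α =
      g.map (algebraMap A _) :=
  mul_divByMonic_eq_iff_isRoot.2 (isRoot_map_x_sq hα)

theorem residualFactor_monic (hg : g.Monic) (hα : α ^ 2 = (-1) ^ (m + 1) * g.coeff 0) :
    (residualFactor m g α).Monic :=
  (monic_X_sub_C _).of_mul_monic_left (by
    rw [X_sub_C_mul_residualFactor hα]
    exact hg.map _)

theorem y_sq_eq (hα : α ^ 2 = (-1) ^ (m + 1) * g.coeff 0) :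
    Quadric.y (residualPoly m g) α ^ 2 = (-1) ^ m * (residualFactor m g α).coeff 0 := by
  rw [Quadric.y_sq, aeval_residualPoly, ← X_sub_C_mul_residualFactor hα, eval_divX_X_sub_C_mul]

theorem natDegree_residualFactor [Nontrivial (Quadric (residualPoly m g) α)] (hg : g.Monic)
    (hgn : g.natDegree = m + 1) : (residualFactor m g α).natDegree = m := by
  rw [residualFactor, natDegree_divByMonic _ (monic_X_sub_C _), hg.natDegree_map, hgn,
    natDegree_X_sub_C, add_tsub_cancel_right]

variable (m g α) in
/-- The type D splitting ring of rank `m` for the roots left after splitting off a first root `x`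
and the product `y` of the others. -/
abbrev ResidualSplit : Type _ :=
  DSplit m (residualFactor m g α) (Quadric.y (residualPoly m g) α)

theorem isTypeDRoots_residual (hα : α ^ 2 = (-1) ^ (m + 1) * g.coeff 0) :
    IsTypeDRoots g α
      (Fin.cons (algebraMap _ (ResidualSplit m g α) (Quadric.x (residualPoly m g) α))
        (etaRoot m (residualFactor m g α) (Quadric.y (residualPoly m g) α))) := by
  have h := isTypeDRoots_etaRoot m (residualFactor m g α) (Quadric.y (residualPoly m g) α)
  have hmap : algebraMap A (ResidualSplit m g α) =
      (algebraMap (Quadric (residualPoly m g) α) (ResidualSplit m g α)).comp (algebraMap A _) :=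
    IsScalarTower.algebraMap_eq _ _ _
  constructor
  · rw [hmap, ← Polynomial.map_map, ← X_sub_C_mul_residualFactor hα, Polynomial.map_mul, h.map_eq,
      Fin.prod_univ_succ]
    simp
  · simp only [Fin.prod_univ_succ, Fin.cons_zero, Fin.cons_succ, h.prod_eq, hmap,
      RingHom.comp_apply, ← map_mul, Quadric.x_mul_y]

theorem IsTypeDRoots.sq_prod_succ {S : Type*} [CommRing S] [Algebra A S] {e : Fin (m + 1) → S}
    (h : IsTypeDRoots g α e) :
    (∏ i : Fin m, e i.succ) ^ 2 = aeval (e 0) (residualPoly m g) := by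
  rw [aeval_residualPoly, h.map_eq, Fin.prod_univ_succ, eval_divX_X_sub_C_mul,
    coeff_zero_prod_X_sub_C_sq, ← mul_assoc, ← mul_pow, neg_mul_neg, one_mul, one_pow, one_mul]

variable (m g α) in
/-- The map sending `x` to the first root and `y` to the product of the other roots. -/
def quadricToDSplit : Quadric (residualPoly m g) α →ₐ[A] DSplit (m + 1) g α :=
  Quadric.lift (etaRoot (m + 1) g α 0) (∏ i : Fin m, etaRoot (m + 1) g α i.succ)
    (isTypeDRoots_etaRoot (m + 1) g α).sq_prod_succ
    (by rw [← Fin.prod_univ_succ, (isTypeDRoots_etaRoot (m + 1) g α).prod_eq])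

instance : Algebra (Quadric (residualPoly m g) α) (DSplit (m + 1) g α) :=
  (quadricToDSplit m g α).toAlgebra

instance : IsScalarTower A (Quadric (residualPoly m g) α) (DSplit (m + 1) g α) :=
  .of_algebraMap_eq fun a ↦ ((quadricToDSplit m g α).commutes a).symm

theorem algebraMap_x : algebraMap (Quadric (residualPoly m g) α) (DSplit (m + 1) g α)
    (Quadric.x _ _) = etaRoot (m + 1) g α 0 :=
  Quadric.lift_x _ _ _ _

theorem isTypeDRoots_etaRoot_succ (hα : α ^ 2 = (-1) ^ (m + 1) * g.coeff 0) :
    IsTypeDRoots (residualFactor m g α) (Quadric.y (residualPoly m g) α)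
      (fun i ↦ etaRoot (m + 1) g α i.succ) where
  map_eq := by
    refine (monic_X_sub_C (etaRoot (m + 1) g α 0 ^ 2)).isRegular.left ?_
    have h := congrArg (Polynomial.map (algebraMap _ (DSplit (m + 1) g α)))
      (X_sub_C_mul_residualFactor hα)
    rwa [Polynomial.map_mul, Polynomial.map_map, ← IsScalarTower.algebraMap_eq,
      (isTypeDRoots_etaRoot (m + 1) g α).map_eq, Fin.prod_univ_succ, Polynomial.map_sub, map_X,
      map_C, map_pow, algebraMap_x] at h
  prod_eq := (Quadric.lift_y _ _ _ _).symm

theorem flat_dSplit_of_flat_residualSplit (hα : α ^ 2 = (-1) ^ (m + 1) * g.coeff 0)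
    [Module.Flat A (ResidualSplit m g α)] : Module.Flat A (DSplit (m + 1) g α) := by
  let toResidual : DSplit (m + 1) g α →ₐ[A] ResidualSplit m g α :=
    DSplit.lift (isTypeDRoots_residual hα)
  let ofResidual : ResidualSplit m g α →ₐ[Quadric (residualPoly m g) α] DSplit (m + 1) g α :=
    DSplit.lift (isTypeDRoots_etaRoot_succ hα)
  refine Module.Flat.of_retract toResidual.toLinearMap (ofResidual.restrictScalars A).toLinearMap
    (congrArg AlgHom.toLinearMap (DSplit.algHom_ext (Fin.cases ?_ fun i ↦ ?_) :
      (ofResidual.restrictScalars A).comp toResidual = AlgHom.id A _))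
  · simp [toResidual, DSplit.lift_etaRoot, algebraMap_x]
  · simp [toResidual, ofResidual, DSplit.lift_etaRoot]

theorem flat_dSplit {n : ℕ} (h2 : IsUnit (2 : A)) (hg : g.Monic) (hgn : g.natDegree = n)
    (hα : α ^ 2 = (-1) ^ n * g.coeff 0) : Module.Flat A (DSplit n g α) := by
  induction n generalizing A with
  | zero =>
    obtain rfl := eq_one_of_monic_natDegree_zero hg hgn
    exact flat_dSplit_zero h2 (by simpa using hα)
  | succ m ih =>
    have : Module.Free A (Quadric (residualPoly m g) α) :=
      Quadric.free (isUnit_leadingCoeff_residualPoly hg hgn)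
    have : Module.Flat A (ResidualSplit m g α) := by
      cases subsingleton_or_nontrivial (Quadric (residualPoly m g) α)
      · have := Module.subsingleton (Quadric (residualPoly m g) α) (ResidualSplit m g α)
        infer_instance
      have h2' := h2.map (algebraMap A (Quadric (residualPoly m g) α))
      rw [map_ofNat] at h2'
      have := ih h2' (residualFactor_monic hg hα) (natDegree_residualFactor hg hgn) (y_sq_eq hα)
      exact Module.Flat.trans A (Quadric (residualPoly m g) α) _
    exact flat_dSplit_of_flat_residualSplit hα

end Flat

/-! ### Discriminants and multiple roots -/

section Discriminant

theorem resultant_derivative_eq {R : Type*} [CommRing R] {g : R[X]} (hg : g.Monic)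
    (h0 : g.natDegree ≠ 0) :
    resultant g g.derivative g.natDegree (g.natDegree - 1) =
      (-1) ^ (g.natDegree * (g.natDegree - 1) / 2) * g.discr := by
  rw [resultant_deriv (natDegree_pos_iff_degree_pos.1 (Nat.pos_of_ne_zero h0)), hg.leadingCoeff,
    mul_one]

theorem map_discr_of_monic {R S : Type*} [CommRing R] [CommRing S] (φ : R →+* S) {g : R[X]}
    (hg : g.Monic) : φ g.discr = (g.map φ).discr := by
  nontriviality S
  have := φ.domain_nontrivial
  by_cases h0 : g.natDegree = 0
  · rw [eq_one_of_monic_natDegree_zero hg h0, Polynomial.map_one, ← C_1, ← C_1, discr_C, discr_C,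
      map_one]
  have hR := congrArg φ (resultant_derivative_eq hg h0)
  have hS := resultant_derivative_eq (hg.map φ) (by rwa [hg.natDegree_map])
  rw [← resultant_map_map, ← derivative_map] at hR
  rw [hg.natDegree_map, hR, map_mul, map_pow, map_neg, map_one] at hS
  exact (isUnit_one.neg.pow _).mul_left_cancel hS

theorem discr_eq_zero_of_sq_dvd {S : Type*} [CommRing S] {g : S[X]} (hg : g.Monic) (w : S)
    (h : (X - C w) ^ 2 ∣ g) : g.discr = 0 := by
  nontriviality S
  obtain ⟨k, hk⟩ := h
  have hroot : g.eval w = 0 := by simp [hk]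
  have hroot' : g.derivative.eval w = 0 := by simp [hk, pow_two, mul_assoc, derivative_mul]
  have h0 : g.natDegree ≠ 0 := fun h0 ↦ by
    simp [eq_one_of_monic_natDegree_zero hg h0] at hroot
  obtain ⟨p, q, -, -, hpq⟩ := exists_mul_add_mul_eq_C_resultant g g.derivative le_rfl
    (natDegree_derivative_le g) (Or.inl h0)
  have heval := congrArg (eval w) hpq
  rw [eval_add, eval_mul, eval_mul, hroot, hroot', zero_mul, zero_mul, add_zero, eval_C,
    resultant_derivative_eq hg h0, eq_comm] at heval
  exact (isUnit_one.neg.pow _).mul_right_eq_zero.1 heval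

theorem adjugate_eq_zero_of_linearIndependent {K ι : Type*} [Field K] [Fintype ι] [DecidableEq ι]
    {M : Matrix ι ι K} {u v : ι → K} (hu : M.mulVec u = 0) (hv : M.mulVec v = 0)
    (huv : LinearIndependent K ![u, v]) : M.adjugate = 0 := by
  ext i j
  rw [LinearIndependent.pair_iff] at huv
  obtain ⟨z, hz, hMz, hzi⟩ : ∃ z, z ≠ 0 ∧ M.mulVec z = 0 ∧ z i = 0 := by
    by_cases hvi : v i = 0
    · exact ⟨v, fun h ↦ one_ne_zero (huv 0 1 (by simp [h])).2, hv, hvi⟩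
    · refine ⟨v i • u + (-u i) • v, fun h ↦ hvi (huv _ _ h).1, ?_, ?_⟩
      · simp [Matrix.mulVec_add, Matrix.mulVec_smul, Matrix.mulVec_neg, hu, hv]
      · simp [mul_comm]
  rw [Matrix.adjugate_apply, Matrix.zero_apply, ← Matrix.exists_mulVec_eq_zero_iff]
  refine ⟨z, hz, funext fun l ↦ ?_⟩
  obtain rfl | hl := eq_or_ne l j
  · simpa [Matrix.mulVec] using hzi
  · simpa [Matrix.mulVec, Matrix.updateRow_ne hl] using congrFun hMz l

section Sylvester

variable {K : Type*} [Field K] {f g H : K[X]} {m n : ℕ}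

theorem adjugate_sylvester_eq_zero_of_linearIndependent (hf : f.natDegree ≤ m)
    (hg : g.natDegree ≤ n) {p q : degreeLT K m × degreeLT K n} (hp : sylvesterMap f g hf hg p = 0)
    (hq : sylvesterMap f g hf hg q = 0) (hpq : LinearIndependent K ![p, q]) :
    (sylvester f g m n).adjugate = 0 := by
  let b := ((degreeLT.basis K m).prod (degreeLT.basis K n)).reindex finSumFinEquiv
  have hker : ∀ z, sylvesterMap f g hf hg z = 0 →
      (sylvester f g m n).mulVec (b.equivFun z) = 0 := by
    intro z hz
    have h := LinearMap.toMatrix_mulVec_repr b (degreeLT.basis K (m + n)) (sylvesterMap f g hf hg) z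
    rwa [toMatrix_sylvesterMap', hz, map_zero] at h
  refine adjugate_eq_zero_of_linearIndependent (hker p hp) (hker q hq) ?_
  rw [LinearIndependent.pair_iff] at hpq ⊢
  intro s t hst
  rw [← map_smul, ← map_smul, ← map_add, LinearEquiv.map_eq_zero_iff] at hst
  exact hpq s t hst

theorem X_pow_mul_mem_degreeLT {F : K[X]} {k : ℕ} (h : F ≠ 0 → k + F.natDegree < m) :
    X ^ k * F ∈ degreeLT K m := by
  obtain rfl | hF := eq_or_ne F 0
  · simp
  · rw [mem_degreeLT, ← natDegree_lt_iff_degree_lt (mul_ne_zero (pow_ne_zero _ X_ne_zero) hF),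
      natDegree_X_pow_mul k hF, add_comm]
    exact h hF

-- If `f = HF` and `g = HG`, both `(-F, G)` and `(-XF, XG)` are syzygies of `(g, f)`.
theorem adjugate_sylvester_eq_zero (hf0 : f ≠ 0) (hf : f.natDegree ≤ m) (hg : g.natDegree ≤ n)
    (hH : 2 ≤ H.natDegree) (hHf : H ∣ f) (hHg : H ∣ g) : (sylvester f g m n).adjugate = 0 := by
  obtain ⟨F, rfl⟩ := hHf
  obtain ⟨G, rfl⟩ := hHg
  have hH0 : H ≠ 0 := left_ne_zero_of_mul hf0
  have hF0 : F ≠ 0 := right_ne_zero_of_mul hf0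
  have hF : ∀ k ≤ 1, X ^ k * F ∈ degreeLT K m := fun k hk ↦ X_pow_mul_mem_degreeLT fun _ ↦ by
    rw [natDegree_mul hH0 hF0] at hf
    lia
  have hG : ∀ k ≤ 1, X ^ k * G ∈ degreeLT K n := fun k hk ↦ X_pow_mul_mem_degreeLT fun hG0 ↦ by
    rw [natDegree_mul hH0 hG0] at hg
    lia
  let z (k : ℕ) (hk : k ≤ 1) : degreeLT K m × degreeLT K n :=
    (-⟨X ^ k * F, hF k hk⟩, ⟨X ^ k * G, hG k hk⟩)
  have hz : ∀ k hk, sylvesterMap (H * F) (H * G) hf hg (z k hk) = 0 := fun k hk ↦ by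
    ext1
    simp only [z, sylvesterMap_apply_coe, Submodule.coe_neg, Submodule.coe_zero]
    ring
  refine adjugate_sylvester_eq_zero_of_linearIndependent hf hg (hz 0 zero_le_one) (hz 1 le_rfl) ?_
  rw [LinearIndependent.pair_iff]
  intro s t hst
  have hfst := congrArg (fun p ↦ (p.1 : K[X])) hst
  have hlin : (C s + C t * X) * F = 0 := by
    simp [z, smul_eq_C_mul] at hfst
    linear_combination -hfst
  have hlin := (mul_eq_zero.1 hlin).resolve_right hF0
  exact ⟨by simpa using congrArg (coeff · 0) hlin, by simpa using congrArg (coeff · 1) hlin⟩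

end Sylvester

section Domain

variable {O : Type*} [CommRing O] [IsDomain O] {π : O}

-- If `π² ∤ det M`, then `det (adj M) = (det M) ^ (n - 1)` is not divisible by `πⁿ`.
theorem sq_dvd_det_of_dvd_adjugate {ι : Type*} [Fintype ι] [DecidableEq ι] [Nonempty ι]
    (hπ : Prime π) {M : Matrix ι ι O} (h : ∀ i j, π ∣ M.adjugate i j) : π ^ 2 ∣ M.det := by
  choose N hN using h
  have hadj : M.adjugate = π • Matrix.of N := by
    ext i j
    simp [hN]
  obtain ⟨k, hk⟩ := Nat.exists_eq_add_one.2 (Fintype.card_pos (α := ι))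
  have hdvd : π ^ (k + 1) ∣ M.det ^ k := by
    have hdet := M.det_adjugate
    rw [hadj, Matrix.det_smul, hk, Nat.add_sub_cancel] at hdet
    exact ⟨_, hdet.symm⟩
  obtain ⟨c, hc⟩ := hπ.dvd_of_dvd_pow ((dvd_pow_self π k.succ_ne_zero).trans hdvd)
  rw [hc, mul_pow, pow_succ, mul_dvd_mul_iff_left (pow_ne_zero _ hπ.ne_zero)] at hdvd
  rw [hc, pow_two]
  exact mul_dvd_mul_left π (hπ.dvd_of_dvd_pow hdvd)

variable {L : Type*} [Field L] {φ : O →+* L} {g : O[X]}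

theorem sq_dvd_discr (hπ : Prime π) (hφ : ∀ a, φ a = 0 → π ∣ a) (hg : g.Monic) {H : L[X]}
    (hH : 2 ≤ H.natDegree) (hHg : H ∣ g.map φ) (hHg' : H ∣ (g.map φ).derivative) :
    π ^ 2 ∣ g.discr := by
  have hdeg : 2 ≤ g.natDegree := by
    rw [← hg.natDegree_map φ]
    exact hH.trans (natDegree_le_of_dvd hHg (hg.map φ).ne_zero)
  have hres : π ^ 2 ∣ resultant g g.derivative g.natDegree (g.natDegree - 1) := by
    have : Nonempty (Fin (g.natDegree + (g.natDegree - 1))) := ⟨⟨0, by lia⟩⟩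
    refine sq_dvd_det_of_dvd_adjugate hπ fun i j ↦ hφ _ ?_
    have hadj := φ.map_adjugate (sylvester g g.derivative g.natDegree (g.natDegree - 1))
    rw [← sylvester_map_map, ← derivative_map, adjugate_sylvester_eq_zero (hg.map φ).ne_zero
      natDegree_map_le
      ((natDegree_derivative_le _).trans (Nat.sub_le_sub_right natDegree_map_le 1))
      hH hHg hHg'] at hadj
    exact congrFun (congrFun hadj i) j
  rw [resultant_derivative_eq hg (by lia)] at hres
  exact (isUnit_one.neg.pow _).dvd_mul_left.1 hres

section MultipleRoots

variable {ι : Type*} [Fintype ι]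

open EuclideanDomain UniqueFactorizationMonoid in
theorem card_le_natDegree_divRadical_add_card_image [DecidableEq L] (w : ι → L) :
    Fintype.card ι ≤ (divRadical (∏ i, (X - C (w i)))).natDegree + (Finset.univ.image w).card := by
  set F := ∏ i, (X - C (w i))
  set P := ∏ b ∈ Finset.univ.image w, (X - C b)
  have hF : F ≠ 0 := (monic_prod_X_sub_C w Finset.univ).ne_zero
  have hP : P ≠ 0 := (monic_prod_X_sub_C id (Finset.univ.image w)).ne_zero
  have hFP : F ∣ P ^ (Fintype.card ι + 1) := by
    rw [pow_succ, ← Finset.card_univ, ← Finset.prod_const]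
    exact (Finset.prod_dvd_prod_of_dvd _ _ fun i _ ↦
      Finset.dvd_prod_of_mem _ (Finset.mem_image_of_mem w (Finset.mem_univ i))).mul_right P
  have hrad : radical F ∣ P := by
    refine (radical_dvd_radical hFP (pow_ne_zero _ hP)).trans ?_
    rw [radical_pow _ (Nat.succ_ne_zero _)]
    exact radical_dvd_self
  have hdegF : F.natDegree = Fintype.card ι := natDegree_finsetProd_X_sub_C_eq_card Finset.univ w
  have hdegP : P.natDegree = (Finset.univ.image w).card :=
    natDegree_finsetProd_X_sub_C_eq_card (Finset.univ.image w) id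
  have hdeg := congrArg natDegree (divRadical_mul_radical (a := F))
  rw [natDegree_mul (divRadical_ne_zero hF) radical_ne_zero, hdegF] at hdeg
  have := natDegree_le_of_dvd hrad hP
  lia

theorem card_image_add_two_le {β : Type*} [DecidableEq β] {w : ι → β} {i j k l : ι} (hij : i ≠ j)
    (hkl : k ≠ l) (hne : s(i, j) ≠ s(k, l)) (hwij : w i = w j) (hwkl : w k = w l) :
    (Finset.univ.image w).card + 2 ≤ Fintype.card ι := by
  classical
  by_contra! hlt
  have hinj : ∀ a b, a ≠ b → w a = w b → Set.InjOn w {a}ᶜ := by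
    intro a b hab hwab
    have himage : (Finset.univ.erase a).image w = Finset.univ.image w := by
      ext y
      simp only [Finset.mem_image, Finset.mem_erase, Finset.mem_univ, and_true, true_and]
      refine ⟨fun ⟨c, _, hc⟩ ↦ ⟨c, hc⟩, fun ⟨c, hc⟩ ↦ ?_⟩
      obtain rfl | hca := eq_or_ne c a
      · exact ⟨b, hab.symm, hwab ▸ hc⟩
      · exact ⟨c, hca, hc⟩
    have hcard : ((Finset.univ.erase a).image w).card = (Finset.univ.erase a).card := by
      refine le_antisymm Finset.card_image_le ?_
      rw [himage, Finset.card_erase_of_mem (Finset.mem_univ a), Finset.card_univ]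
      lia
    simpa [Set.compl_eq_univ_sdiff] using Finset.injOn_of_card_image_eq hcard
  have hmem : ∀ a b, a ≠ b → w a = w b → k = a ∨ l = a := by
    intro a b hab hwab
    by_contra! h
    exact hkl (hinj a b hab hwab h.1 h.2 hwkl)
  have hi := hmem i j hij hwij
  have hj := hmem j i hij.symm hwij.symm
  grind [Sym2.eq_iff]

theorem sq_dvd_discr_of_two_pairs (hπ : Prime π) (hφ : ∀ a, φ a = 0 → π ∣ a) (hg : g.Monic)
    {w : ι → L} (hw : g.map φ = ∏ i, (X - C (w i))) {i j k l : ι} (hij : i ≠ j) (hkl : k ≠ l)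
    (hne : s(i, j) ≠ s(k, l)) (hwij : w i = w j) (hwkl : w k = w l) : π ^ 2 ∣ g.discr := by
  classical
  have hdeg := card_le_natDegree_divRadical_add_card_image w
  rw [← hw] at hdeg
  have hcard := card_image_add_two_le hij hkl hne hwij hwkl
  exact sq_dvd_discr hπ hφ hg (by lia) (Dvd.intro _ EuclideanDomain.divRadical_mul_radical)
    (divRadical_dvd_derivative _)

end MultipleRoots

end Domain

end Discriminant

/-! ### Unramified local algebras and simple roots -/

section Unramified

section SimpleRoots

variable {O S : Type*} [CommRing O] [CommRing S] [Algebra O S]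

theorem kaehlerDifferential_D_eq_zero_of_simple_root {t : S} {p : O[X]} (hp : aeval t p = 0)
    (hp' : IsUnit (aeval t p.derivative)) : KaehlerDifferential.D O S t = 0 := by
  have h := (KaehlerDifferential.D O S).map_aeval p t
  rw [hp, map_zero] at h
  exact hp'.smul_eq_zero.1 h.symm

theorem derivation_eq_zero_of_mem_adjoin {M : Type*} [AddCommGroup M] [Module O M] [Module S M]
    (D : Derivation O S M) {T : Set S} (h : ∀ t ∈ T, D t = 0) {x : S}
    (hx : x ∈ Algebra.adjoin O T) : D x = 0 :=
  Derivation.eqOn_adjoin (D2 := 0) h hx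

variable (O) in
/-- A set `T` essentially generates the `O`-algebra `S` if `S` is obtained from its subalgebra
`O[T]` by inverting elements. -/
def IsEssGenerating (T : Set S) : Prop :=
  ∀ x : S, ∃ s ∈ Algebra.adjoin O T, IsUnit s ∧ x * s ∈ Algebra.adjoin O T

theorem IsEssGenerating.essFiniteType {T : Set S} (hT : IsEssGenerating O T) (hfin : T.Finite) :
    Algebra.EssFiniteType O S :=
  (Algebra.essFiniteType_iff O S).2 ⟨hfin.toFinset, by rwa [hfin.coe_toFinset]⟩

theorem IsEssGenerating.image {S' : Type*} [CommRing S'] [Algebra O S'] {T : Set S}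
    (hT : IsEssGenerating O T) {f : S →ₐ[O] S'} (hf : Function.Surjective f) :
    IsEssGenerating O (f '' T) := by
  intro y
  obtain ⟨x, rfl⟩ := hf y
  obtain ⟨s, hs, hsu, hxs⟩ := hT x
  rw [← AlgHom.map_adjoin]
  exact ⟨f s, ⟨s, hs, rfl⟩, hsu.map f, x * s, hxs, map_mul f x s⟩

theorem formallyUnramified_of_simple_roots {T : Set S} (hT : IsEssGenerating O T)
    (h : ∀ t ∈ T, ∃ p : O[X], aeval t p = 0 ∧ IsUnit (aeval t p.derivative)) :
    Algebra.FormallyUnramified O S := by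
  have hadjoin : ∀ x ∈ Algebra.adjoin O T, KaehlerDifferential.D O S x = 0 := by
    refine fun x ↦ derivation_eq_zero_of_mem_adjoin _ fun t ht ↦ ?_
    obtain ⟨p, hp, hp'⟩ := h t ht
    exact kaehlerDifferential_D_eq_zero_of_simple_root hp hp'
  have hD : ∀ x, KaehlerDifferential.D O S x = 0 := by
    intro x
    obtain ⟨s, hs, hunit, hxs⟩ := hT x
    have hleibniz := hadjoin _ hxs
    rw [Derivation.leibniz, hadjoin _ hs, smul_zero, zero_add] at hleibniz
    exact hunit.smul_eq_zero.1 hleibniz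
  have htop : (⊤ : Submodule S (Ω[S⁄O])) = ⊥ := by
    rw [← KaehlerDifferential.span_range_derivation, Submodule.span_eq_bot]
    rintro _ ⟨x, rfl⟩
    exact hD x
  rw [Algebra.formallyUnramified_iff]
  exact (Submodule.subsingleton_iff S).1 (subsingleton_of_bot_eq_top htop.symm)

section ProdXSubC

variable {ι : Type*} [Fintype ι] (w : ι → S)

theorem eval_prod_X_sub_C (i : ι) : (∏ a, (X - C (w a))).eval (w i) = 0 := by
  rw [eval_prod]
  exact Finset.prod_eq_zero (Finset.mem_univ i) (by simp)

variable [DecidableEq ι]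

theorem eval_derivative_prod_X_sub_C (i : ι) :
    (∏ a, (X - C (w a))).derivative.eval (w i) = ∏ a ∈ Finset.univ.erase i, (w i - w a) := by
  rw [← Finset.mul_prod_erase Finset.univ _ (Finset.mem_univ i)]
  simp [derivative_mul, eval_prod]

theorem eval_derivative_derivative_prod_X_sub_C {k l : ι} (hkl : k ≠ l) (h : w k = w l) :
    (∏ a, (X - C (w a))).derivative.derivative.eval (w k) =
      2 * ∏ a ∈ (Finset.univ.erase k).erase l, (w k - w a) := by
  have hl : l ∈ Finset.univ.erase k := by simp [hkl.symm]
  rw [← Finset.mul_prod_erase Finset.univ _ (Finset.mem_univ k),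
    ← Finset.mul_prod_erase (Finset.univ.erase k) _ hl]
  simp only [derivative_mul, derivative_sub, derivative_X, derivative_C, sub_zero, one_mul,
    derivative_add, eval_add, eval_mul, eval_sub, eval_X, eval_C, h, sub_self, zero_mul, add_zero,
    eval_prod]
  ring

end ProdXSubC

theorem exists_simple_root_of_sq (h2 : IsUnit (2 : S)) {p : O[X]} {t : S} (ht : IsUnit t)
    (hp : aeval (t ^ 2) p = 0) (hp' : IsUnit (aeval (t ^ 2) p.derivative)) :
    ∃ q : O[X], aeval t q = 0 ∧ IsUnit (aeval t q.derivative) := by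
  refine ⟨expand O 2 p, by rwa [expand_aeval], ?_⟩
  rw [derivative_expand]
  simpa only [map_mul, expand_aeval, Nat.cast_ofNat, map_ofNat, Nat.add_one_sub_one, pow_one,
    aeval_X] using hp'.mul (h2.mul ht)

variable {n : ℕ} {g : O[X]} {α : O} {e : Fin n → S}

theorem IsTypeDRoots.exists_simple (h : IsTypeDRoots g α e) (h2 : IsUnit (2 : S)) {i : Fin n}
    (hi : IsUnit (e i)) (hij : ∀ j, j ≠ i → IsUnit (e i ^ 2 - e j ^ 2)) :
    ∃ p : O[X], aeval (e i) p = 0 ∧ IsUnit (aeval (e i) p.derivative) := by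
  refine exists_simple_root_of_sq (p := g) h2 hi ?_ ?_
  · rw [← eval_map_algebraMap, h.map_eq, eval_prod_X_sub_C (fun a ↦ e a ^ 2) i]
  · rw [← eval_map_algebraMap, ← derivative_map, h.map_eq,
      eval_derivative_prod_X_sub_C (fun a ↦ e a ^ 2) i, IsUnit.prod_iff]
    exact fun j hj ↦ hij j (Finset.ne_of_mem_erase hj)

-- A double root of `g` is a simple root of `g'`, as `2` is invertible.
theorem IsTypeDRoots.exists_simple_of_double (h : IsTypeDRoots g α e) (h2 : IsUnit (2 : S))
    {k l : Fin n} (hkl : k ≠ l) (he : e k ^ 2 = e l ^ 2) (hk : IsUnit (e k))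
    (hj : ∀ j, j ≠ k → j ≠ l → IsUnit (e k ^ 2 - e j ^ 2)) :
    ∃ p : O[X], aeval (e k) p = 0 ∧ IsUnit (aeval (e k) p.derivative) := by
  refine exists_simple_root_of_sq (p := g.derivative) h2 hk ?_ ?_
  · rw [← eval_map_algebraMap, ← derivative_map, h.map_eq,
      eval_derivative_prod_X_sub_C (fun a ↦ e a ^ 2) k]
    exact Finset.prod_eq_zero (i := l) (by simp [hkl.symm]) (by simp [he])
  · rw [← eval_map_algebraMap, ← derivative_map, ← derivative_map, h.map_eq,
      eval_derivative_derivative_prod_X_sub_C (fun a ↦ e a ^ 2) hkl he]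
    refine h2.mul (IsUnit.prod_iff.2 fun j hj' ↦ ?_)
    simp only [Finset.mem_erase, Finset.mem_univ, and_true] at hj'
    exact hj j hj'.2 hj'.1

end SimpleRoots

section PrincipalMaximalIdeal

variable {R : Type*} [CommRing R] [IsLocalRing R] {t : R}

theorem maximalIdeal_eq_span_of_formallyUnramified {O : Type*} [CommRing O] [IsLocalRing O]
    [Algebra O R] [IsLocalHom (algebraMap O R)] [Algebra.EssFiniteType O R]
    (ht : t ∈ maximalIdeal R) (hdvd : ∀ a ∈ maximalIdeal O, t ∣ algebraMap O R a)
    (hur : Algebra.FormallyUnramified O (R ⧸ Ideal.span {t})) :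
    maximalIdeal R = Ideal.span {t} := by
  have hle : Ideal.span {t} ≤ maximalIdeal R := by rwa [Ideal.span_le, Set.singleton_subset_iff]
  have : Nontrivial (R ⧸ Ideal.span {t}) :=
    Ideal.Quotient.nontrivial_iff.2 (ne_top_of_le_ne_top (maximalIdeal.isMaximal R).ne_top hle)
  have : IsLocalRing (R ⧸ Ideal.span {t}) := .of_surjective' _ Ideal.Quotient.mk_surjective
  have : IsLocalHom (Ideal.Quotient.mk (Ideal.span {t})) :=
    IsLocalHom.of_surjective _ Ideal.Quotient.mk_surjective
  have : IsLocalHom (algebraMap O (R ⧸ Ideal.span {t})) := by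
    rw [IsScalarTower.algebraMap_eq O R]
    exact RingHom.isLocalHom_comp _ _
  have hbot : maximalIdeal (R ⧸ Ideal.span {t}) = ⊥ := by
    rw [← Algebra.FormallyUnramified.map_maximalIdeal (R := O), eq_bot_iff,
      Ideal.map_le_iff_le_comap]
    intro a ha
    rw [Ideal.mem_comap, IsScalarTower.algebraMap_apply O R, Ideal.mem_bot,
      Ideal.Quotient.algebraMap_eq, Ideal.Quotient.eq_zero_iff_mem, Ideal.mem_span_singleton]
    exact hdvd a ha
  refine le_antisymm (fun x hx ↦ ?_) hle
  rw [← Ideal.Quotient.eq_zero_iff_mem, ← Ideal.mem_bot, ← hbot, mem_maximalIdeal,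
    mem_nonunits_iff]
  exact fun hu ↦ hx (isUnit_of_map_unit (Ideal.Quotient.mk (Ideal.span {t})) x hu)

theorem maximalIdeal_eq_span_of_simple_roots {O : Type*} [CommRing O] [IsLocalRing O]
    [Algebra O R] [IsLocalHom (algebraMap O R)] {T : Set R} (hT : IsEssGenerating O T)
    (hfin : T.Finite) (ht : t ∈ maximalIdeal R) (hdvd : ∀ a ∈ maximalIdeal O, t ∣ algebraMap O R a)
    (h : ∀ x ∈ T, ∃ p : O[X], aeval (Ideal.Quotient.mkₐ O (Ideal.span {t}) x) p = 0 ∧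
      IsUnit (aeval (Ideal.Quotient.mkₐ O (Ideal.span {t}) x) p.derivative)) :
    maximalIdeal R = Ideal.span {t} := by
  have := hT.essFiniteType hfin
  refine maximalIdeal_eq_span_of_formallyUnramified ht hdvd
    (formallyUnramified_of_simple_roots (hT.image (Ideal.Quotient.mkₐ_surjective O _)) ?_)
  rintro _ ⟨x, hx, rfl⟩
  exact h x hx

variable [IsNoetherianRing R]

theorem exists_eq_pow_mul_isUnit (ht : maximalIdeal R = Ideal.span {t}) {a : R} (ha : a ≠ 0) :
    ∃ k u, IsUnit u ∧ a = t ^ k * u := by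
  have hfin : FiniteMultiplicity t a := by
    have hinf : a ∉ ⨅ k : ℕ, maximalIdeal R ^ k := by
      rwa [Ideal.iInf_pow_eq_bot_of_isLocalRing _ (maximalIdeal.isMaximal R).ne_top]
    obtain ⟨k, hk⟩ := not_forall.1 (mt (Submodule.mem_iInf _).2 hinf)
    rw [ht, Ideal.span_singleton_pow, Ideal.mem_span_singleton] at hk
    exact ⟨k, fun h ↦ hk ((pow_dvd_pow t k.le_succ).trans h)⟩
  obtain ⟨u, hau, hu⟩ := hfin.exists_eq_pow_mul_and_not_dvd
  rw [← Ideal.mem_span_singleton, ← ht, mem_maximalIdeal, mem_nonunits_iff, not_not] at hu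
  exact ⟨_, u, hu, hau⟩

theorem isDomain_of_maximalIdeal_eq_span (ht : maximalIdeal R = Ideal.span {t})
    (h0 : t = 0 ∨ t ∈ R⁰) : IsDomain R := by
  obtain rfl | h0 := h0
  · rw [Ideal.span_singleton_zero, ← isField_iff_maximalIdeal_eq] at ht
    exact ht.isDomain
  have hreg : ∀ a : R, a ≠ 0 → a ∈ R⁰ := by
    intro a ha
    obtain ⟨k, u, hu, rfl⟩ := exists_eq_pow_mul_isUnit ht ha
    exact mul_mem (pow_mem h0 k) hu.mem_nonZeroDivisors
  have : NoZeroDivisors R := .mk fun {a b} hab ↦ or_iff_not_imp_right.2 fun hb ↦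
    (mul_right_mem_nonZeroDivisors_eq_zero_iff (hreg b hb)).1 hab
  exact NoZeroDivisors.to_isDomain R

theorem isIntegrallyClosed_of_maximalIdeal_eq_span [IsDomain R]
    (ht : maximalIdeal R = Ideal.span {t}) : IsIntegrallyClosed R := by
  have htfae := (tfae_of_isNoetherianRing_of_isLocalRing_of_isDomain R).out 4 0
  have : IsPrincipalIdealRing R := htfae.1 ⟨⟨t, ht⟩⟩
  infer_instance

end PrincipalMaximalIdeal

end Unramified

/-! ### Degeneracies over a local base -/

section Degeneracy

/-- The index set of the degeneracies of `n` elements: the indices `i` (for `eᵢ = 0`) and the pairs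
`i < j` (for `eᵢ² = eⱼ²`). -/
abbrev DegeneracyIndex (n : ℕ) : Type := Fin n ⊕ {q : Fin n × Fin n // q.1 < q.2}

variable {n : ℕ}

/-- The elements `eᵢ` and `eᵢ² - eⱼ²` (`i < j`): the analogue of `degeneracy` for an arbitrary
family of elements. -/
def rootDegeneracy {S : Type*} [CommRing S] (e : Fin n → S) : DegeneracyIndex n → S
  | Sum.inl i => e i
  | Sum.inr q => e q.1.1 ^ 2 - e q.1.2 ^ 2

theorem degeneracy_eq_rootDegeneracy {A : Type*} [CommRing A] (g : A[X]) (α : A) :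
    degeneracy n g α = rootDegeneracy (etaRoot n g α) := by
  ext s
  cases s <;> rfl

theorem map_rootDegeneracy {S T F : Type*} [CommRing S] [CommRing T] [FunLike F S T]
    [RingHomClass F S T] (φ : F) (e : Fin n → S) (s : DegeneracyIndex n) :
    φ (rootDegeneracy e s) = rootDegeneracy (fun i ↦ φ (e i)) s := by
  cases s <;> simp [rootDegeneracy]

theorem map_reducedDiscr {A R : Type*} [CommRing A] [CommRing R] (φ : A →+* R) {g : A[X]}
    (hg : g.Monic) (α : A) : φ (reducedDiscr g α) = reducedDiscr (g.map φ) (φ α) := by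
  rw [reducedDiscr, reducedDiscr, map_mul, map_discr_of_monic φ hg]

theorem isUnit_sq_sub_sq {S : Type*} [CommRing S] {e : Fin n → S} {i j : Fin n} (hij : i ≠ j)
    (h : ∀ q : {q : Fin n × Fin n // q.1 < q.2}, s(q.1.1, q.1.2) = s(i, j) →
      IsUnit (rootDegeneracy e (Sum.inr q))) : IsUnit (e i ^ 2 - e j ^ 2) := by
  obtain hlt | hlt := lt_or_gt_of_ne hij
  · exact h ⟨(i, j), hlt⟩ rfl
  · rw [← neg_sub]
    exact (h ⟨(j, i), hlt⟩ Sym2.eq_swap).neg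

variable {O R : Type*} [CommRing O] [CommRing R] [Algebra O R] {g : O[X]} {α : O} {e : Fin n → R}

theorem IsTypeDRoots.algebraMap_discr_eq_zero (h : IsTypeDRoots g α e) (hg : g.Monic)
    {k l : Fin n} (hkl : k ≠ l) (he : e k ^ 2 = e l ^ 2) : algebraMap O R g.discr = 0 := by
  rw [map_discr_of_monic _ hg]
  refine discr_eq_zero_of_sq_dvd (hg.map _) (e k ^ 2) ?_
  rw [h.map_eq, pow_two (X - C (e k ^ 2))]
  nth_rw 2 [he]
  rw [← Finset.prod_pair (f := fun a ↦ X - C (e a ^ 2)) hkl]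
  exact Finset.prod_dvd_prod_of_subset _ _ _ (Finset.subset_univ _)

theorem IsTypeDRoots.rootDegeneracy_dvd (h : IsTypeDRoots g α e) (hg : g.Monic)
    (s : DegeneracyIndex n) : rootDegeneracy e s ∣ algebraMap O R (reducedDiscr g α) := by
  rw [reducedDiscr, map_mul]
  obtain i | ⟨⟨k, l⟩, hkl⟩ := s
  · rw [← h.prod_eq]
    exact (Finset.dvd_prod_of_mem e (Finset.mem_univ i)).mul_right _
  · refine Dvd.dvd.mul_left ?_ _
    set t := rootDegeneracy e (Sum.inr ⟨(k, l), hkl⟩)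
    rw [← Ideal.mem_span_singleton, ← Ideal.Quotient.eq_zero_iff_mem]
    refine (h.map (Ideal.Quotient.mkₐ O (Ideal.span {t}))).algebraMap_discr_eq_zero hg hkl.ne ?_
    rw [← map_pow, ← map_pow]
    exact Ideal.Quotient.eq.2 (Ideal.mem_span_singleton_self t)

theorem IsTypeDRoots.sq_dvd_reducedDiscr {L : Type*} [IsDomain O] [Field L] [Algebra O L] {π : O}
    (hπ : Prime π) (hφ : ∀ a, algebraMap O L a = 0 → π ∣ a) {e : Fin n → L}
    (h : IsTypeDRoots g α e) (hg : g.Monic) {s s' : DegeneracyIndex n} (hss : s ≠ s')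
    (hs : rootDegeneracy e s = 0) (hs' : rootDegeneracy e s' = 0) :
    π ^ 2 ∣ reducedDiscr g α := by
  have hα : ∀ i, e i = 0 → π ∣ α := fun i hi ↦ hφ α <| by
    rw [← h.prod_eq, Finset.prod_eq_zero (Finset.mem_univ i) hi]
  have hdiscr : ∀ k l, k ≠ l → e k ^ 2 = e l ^ 2 → π ∣ g.discr := fun k l hkl he ↦
    hφ _ (h.algebraMap_discr_eq_zero hg hkl he)
  obtain i | ⟨⟨i, j⟩, hij⟩ := s <;> obtain k | ⟨⟨k, l⟩, hkl⟩ := s'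
  · rw [pow_two]
    refine mul_dvd_mul (hα i hs) (hdiscr i k (by simpa using hss) ?_)
    simp only [rootDegeneracy] at hs hs'
    rw [hs, hs']
  · rw [pow_two]
    exact mul_dvd_mul (hα i hs) (hdiscr k l hkl.ne (sub_eq_zero.1 hs'))
  · rw [pow_two]
    exact mul_dvd_mul (hα k hs') (hdiscr i j hij.ne (sub_eq_zero.1 hs))
  · refine (sq_dvd_discr_of_two_pairs hπ hφ hg h.map_eq hij.ne hkl.ne ?_ (sub_eq_zero.1 hs)
      (sub_eq_zero.1 hs')).mul_left α
    dsimp only at hij hkl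
    grind [Sym2.eq_iff]

theorem IsTypeDRoots.exists_simple_of_unique_double (h : IsTypeDRoots g α e) (h2 : IsUnit (2 : R))
    (he : ∀ i, IsUnit (e i)) {k l : Fin n} (hkl : k ≠ l) (hsq : e k ^ 2 = e l ^ 2)
    (hu : ∀ i j, i ≠ j → s(i, j) ≠ s(k, l) → IsUnit (e i ^ 2 - e j ^ 2)) (i : Fin n) :
    ∃ p : O[X], aeval (e i) p = 0 ∧ IsUnit (aeval (e i) p.derivative) := by
  obtain rfl | hik := eq_or_ne i k
  · exact h.exists_simple_of_double h2 hkl hsq (he i) fun j hj hjl ↦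
      hu i j hj.symm (by simp [hjl, hkl])
  obtain rfl | hil := eq_or_ne i l
  · exact h.exists_simple_of_double h2 hkl.symm hsq.symm (he i) fun j hj hjk ↦
      hu i j hj.symm (by simp [hjk, hik])
  · exact h.exists_simple h2 (he i) fun j hj ↦ hu i j hj.symm (by simp [hik, hil])

theorem IsTypeDRoots.exists_simple_of_unique_degeneracy (h : IsTypeDRoots g α e)
    (h2 : IsUnit (2 : R)) {s : DegeneracyIndex n} (hs : rootDegeneracy e s = 0)
    (hu : ∀ s', s' ≠ s → IsUnit (rootDegeneracy e s')) (i : Fin n) :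
    ∃ p : O[X], aeval (e i) p = 0 ∧ IsUnit (aeval (e i) p.derivative) := by
  obtain k | ⟨⟨k, l⟩, hkl⟩ := s
  · obtain rfl | hik := eq_or_ne i k
    · exact ⟨X, by simpa [rootDegeneracy] using hs, by simp⟩
    · exact h.exists_simple h2 (hu (Sum.inl i) (by simpa using hik)) fun j hj ↦
        isUnit_sq_sub_sq hj.symm fun q _ ↦ hu _ (by simp)
  · refine h.exists_simple_of_unique_double h2 (fun i ↦ hu (Sum.inl i) (by simp)) hkl.ne
      (sub_eq_zero.1 hs) (fun a b hab hne ↦ isUnit_sq_sub_sq hab fun q hq ↦ hu _ ?_) i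
    rintro hqs
    rw [Sum.inr.injEq] at hqs
    subst hqs
    exact hne hq.symm

end Degeneracy

section Local

variable {O R : Type*} [CommRing O] [CommRing R] [IsLocalRing R] [Algebra O R] {n : ℕ} {g : O[X]}
  {α : O} {e : Fin n → R}

theorem IsTypeDRoots.reducedDiscr_mem_maximalIdeal_sq [IsDomain O] [IsDiscreteValuationRing O]
    (h : IsTypeDRoots g α e) (hg : g.Monic) {s s' : DegeneracyIndex n} (hss : s ≠ s')
    (hs : rootDegeneracy e s ∈ maximalIdeal R) (hs' : rootDegeneracy e s' ∈ maximalIdeal R) :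
    reducedDiscr g α ∈ maximalIdeal O ^ 2 := by
  obtain ⟨π, hπ⟩ := IsDiscreteValuationRing.exists_irreducible O
  have hker : ∀ a, algebraMap O (ResidueField R) a = 0 → π ∣ a := by
    intro a ha
    rw [IsScalarTower.algebraMap_apply O R, ResidueField.algebraMap_eq, residue_eq_zero_iff] at ha
    rw [← Ideal.mem_span_singleton, ← hπ.maximalIdeal_eq]
    exact fun hu ↦ ha (hu.map _)
  rw [hπ.maximalIdeal_eq, Ideal.span_singleton_pow, Ideal.mem_span_singleton]
  refine (h.map (IsScalarTower.toAlgHom O R (ResidueField R))).sq_dvd_reducedDiscr hπ.prime hker hg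
    hss ?_ ?_
  · rw [← map_rootDegeneracy]
    exact (residue_eq_zero_iff _).2 hs
  · rw [← map_rootDegeneracy]
    exact (residue_eq_zero_iff _).2 hs'

variable [IsLocalRing O] [IsLocalHom (algebraMap O R)]

theorem IsTypeDRoots.maximalIdeal_eq_span_rootDegeneracy (h : IsTypeDRoots g α e)
    (hg : g.Monic) (h2 : IsUnit (2 : R)) (hgen : IsEssGenerating O (Set.range e))
    (hΔ : ∀ a ∈ maximalIdeal O, reducedDiscr g α ∣ a) {s : DegeneracyIndex n}
    (hs : rootDegeneracy e s ∈ maximalIdeal R)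
    (hu : ∀ s', s' ≠ s → IsUnit (rootDegeneracy e s')) :
    maximalIdeal R = Ideal.span {rootDegeneracy e s} := by
  set t := rootDegeneracy e s
  let mk := Ideal.Quotient.mkₐ O (Ideal.span {t})
  refine maximalIdeal_eq_span_of_simple_roots hgen (Set.finite_range e) hs
    (fun a ha ↦ (h.rootDegeneracy_dvd hg s).trans (_root_.map_dvd _ (hΔ a ha))) ?_
  rintro _ ⟨i, rfl⟩
  refine (h.map mk).exists_simple_of_unique_degeneracy (s := s) ?_ ?_ (fun s' hs' ↦ ?_) i
  · simpa only [map_ofNat] using h2.map mk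
  · rw [← map_rootDegeneracy]
    exact Ideal.Quotient.eq_zero_iff_mem.2 (Ideal.mem_span_singleton_self t)
  · rw [← map_rootDegeneracy]
    exact (hu s' hs').map mk

theorem IsTypeDRoots.maximalIdeal_eq_span_algebraMap (h : IsTypeDRoots g α e)
    (h2 : IsUnit (2 : R)) (hgen : IsEssGenerating O (Set.range e)) {π : O}
    (hπ : maximalIdeal O = Ideal.span {π}) (hu : ∀ s, IsUnit (rootDegeneracy e s)) :
    maximalIdeal R = Ideal.span {algebraMap O R π} := by
  have hπmem : algebraMap O R π ∈ maximalIdeal R :=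
    map_nonunit _ π (hπ ▸ Ideal.mem_span_singleton_self π)
  have hdvd : ∀ a ∈ maximalIdeal O, algebraMap O R π ∣ algebraMap O R a := fun a ha ↦ by
    rw [hπ, Ideal.mem_span_singleton] at ha
    exact _root_.map_dvd _ ha
  let mk := Ideal.Quotient.mkₐ O (Ideal.span {algebraMap O R π})
  refine maximalIdeal_eq_span_of_simple_roots hgen (Set.finite_range e) hπmem hdvd ?_
  rintro _ ⟨i, rfl⟩
  refine (h.map mk).exists_simple (map_ofNat mk 2 ▸ h2.map mk) ((hu (Sum.inl i)).map mk)
    fun j hj ↦ isUnit_sq_sub_sq (e := fun i ↦ mk (e i)) hj.symm fun q _ ↦ ?_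
  rw [← map_rootDegeneracy]
  exact (hu _).map mk

theorem IsTypeDRoots.isDomain_and_isIntegrallyClosed [IsDomain O] [IsNoetherianRing R]
    [Module.Flat O R] (h : IsTypeDRoots g α e) (hg : g.Monic) (h2 : IsUnit (2 : R))
    (hgen : IsEssGenerating O (Set.range e)) {π : O} (hπ : maximalIdeal O = Ideal.span {π})
    (hΔ0 : reducedDiscr g α ≠ 0) (hΔ : reducedDiscr g α ∣ π)
    (hE : ∀ s s', s ≠ s' → rootDegeneracy e s ∈ maximalIdeal R →
      rootDegeneracy e s' ∉ maximalIdeal R) :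
    IsDomain R ∧ IsIntegrallyClosed R := by
  have hreg : ∀ a : O, a ≠ 0 → algebraMap O R a ∈ R⁰ := fun a ha ↦
    mem_nonZeroDivisors_iff_right.2 fun x hx ↦
      (smul_eq_zero_iff_right ha).1 (by rwa [Algebra.smul_def, mul_comm])
  obtain ⟨t, ht, ht0⟩ : ∃ t, maximalIdeal R = Ideal.span {t} ∧ (t = 0 ∨ t ∈ R⁰) := by
    by_cases hdeg : ∃ s, rootDegeneracy e s ∈ maximalIdeal R
    · obtain ⟨s, hs⟩ := hdeg
      refine ⟨_, h.maximalIdeal_eq_span_rootDegeneracy hg h2 hgen (fun a ha ↦ ?_) hs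
        fun s' hs' ↦ of_not_not (hE s s' hs'.symm hs), Or.inr ?_⟩
      · rw [hπ, Ideal.mem_span_singleton] at ha
        exact hΔ.trans ha
      · obtain ⟨c, hc⟩ := h.rootDegeneracy_dvd hg s
        exact (mul_mem_nonZeroDivisors.1 (hc ▸ hreg _ hΔ0)).1
    · refine ⟨_, h.maximalIdeal_eq_span_algebraMap h2 hgen hπ fun s ↦
        of_not_not fun hs ↦ hdeg ⟨s, hs⟩, ?_⟩
      obtain rfl | hπ0 := eq_or_ne π 0
      · exact Or.inl (map_zero _)
      · exact Or.inr (hreg π hπ0)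
  have := isDomain_of_maximalIdeal_eq_span ht ht0
  exact ⟨this, isIntegrallyClosed_of_maximalIdeal_eq_span ht⟩

end Local

/-! ### Local rings of the splitting ring -/

section Localization

theorem IsTypeDRoots.of_isScalarTower {A O S : Type*} [CommRing A] [CommRing O] [CommRing S]
    [Algebra A O] [Algebra O S] [Algebra A S] [IsScalarTower A O S] {n : ℕ} {g : A[X]} {α : A}
    {e : Fin n → S} (h : IsTypeDRoots g α e) :
    IsTypeDRoots (g.map (algebraMap A O)) (algebraMap A O α) e where
  map_eq := by rw [Polynomial.map_map, ← IsScalarTower.algebraMap_eq, h.map_eq]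
  prod_eq := by rw [← IsScalarTower.algebraMap_apply, h.prod_eq]

theorem algebraMap_mem_adjoin_image {A O B S : Type*} [CommRing A] [CommRing O] [CommRing B]
    [CommRing S] [Algebra A O] [Algebra A B] [Algebra O S] [Algebra B S] [Algebra A S]
    [IsScalarTower A O S] [IsScalarTower A B S] {T : Set B} {b : B}
    (hb : b ∈ Algebra.adjoin A T) : algebraMap B S b ∈ Algebra.adjoin O (algebraMap B S '' T) := by
  induction hb using Algebra.adjoin_induction with
  | mem b hb => exact Algebra.subset_adjoin ⟨b, hb, rfl⟩
  | algebraMap a =>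
    rw [← IsScalarTower.algebraMap_apply, IsScalarTower.algebraMap_apply A O S]
    exact Subalgebra.algebraMap_mem _ _
  | add b c _ _ hb hc => exact map_add (algebraMap B S) b c ▸ add_mem hb hc
  | mul b c _ _ hb hc => exact map_mul (algebraMap B S) b c ▸ mul_mem hb hc

theorem isEssGenerating_of_isLocalization {A B S : Type*} (O : Type*) [CommRing A] [CommRing O]
    [CommRing B] [CommRing S] [Algebra A O] [Algebra A B] [Algebra O S] [Algebra B S] [Algebra A S]
    [IsScalarTower A O S] [IsScalarTower A B S] (M : Submonoid B) [IsLocalization M S] {T : Set B}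
    (hT : Algebra.adjoin A T = ⊤) : IsEssGenerating O (algebraMap B S '' T) := by
  have hmem (b : B) : algebraMap B S b ∈ Algebra.adjoin O (algebraMap B S '' T) :=
    algebraMap_mem_adjoin_image (A := A) (hT ▸ Algebra.mem_top)
  intro y
  obtain ⟨b, s, rfl⟩ := IsLocalization.exists_mk'_eq M y
  refine ⟨algebraMap B S s, hmem s, IsLocalization.map_units S s, ?_⟩
  rw [IsLocalization.mk'_spec]
  exact hmem b

variable {A : Type*} [CommRing A] (n : ℕ) (g : A[X]) (α : A)

theorem adjoin_range_etaRoot : Algebra.adjoin A (Set.range (etaRoot n g α)) = ⊤ := by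
  have h := congrArg (Subalgebra.map (Ideal.Quotient.mkₐ A (splitIdeal n g α)))
    (MvPolynomial.adjoin_range_X (R := A) (σ := Fin n))
  rw [AlgHom.map_adjoin, ← Set.range_comp, Algebra.map_top,
    (AlgHom.range_eq_top _).2 (Ideal.Quotient.mkₐ_surjective A _)] at h
  exact h

variable {n g α} (q : Ideal (DSplit n g α)) [q.IsPrime]

/-- The images of the roots `ηᵢ` in the local ring of the splitting ring at `q`. -/
def localEtaRoot (i : Fin n) : Localization.AtPrime q :=
  algebraMap (DSplit n g α) (Localization.AtPrime q) (etaRoot n g α i)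

theorem rootDegeneracy_localEtaRoot_mem_iff (s : DegeneracyIndex n) :
    rootDegeneracy (localEtaRoot q) s ∈ maximalIdeal (Localization.AtPrime q) ↔
      degeneracy n g α s ∈ q := by
  rw [degeneracy_eq_rootDegeneracy,
    ← IsLocalization.AtPrime.to_map_mem_maximal_iff (Localization.AtPrime q) q, map_rootDegeneracy]
  rfl

variable [Algebra (Localization.AtPrime (q.under A)) (Localization.AtPrime q)]
  [Localization.AtPrime.IsLiesOverAlgebra (q.under A) q]

theorem isLocalHom_of_isLiesOverAlgebra :
    IsLocalHom (algebraMap (Localization.AtPrime (q.under A)) (Localization.AtPrime q)) := by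
  rw [Localization.AtPrime.IsLiesOverAlgebra.algebraMap_eq (p := q.under A) (P := q)]
  exact Localization.isLocalHom_localRingHom _ _ _ _

theorem isTypeDRoots_localEtaRoot :
    IsTypeDRoots (g.map (algebraMap A (Localization.AtPrime (q.under A))))
      (algebraMap A (Localization.AtPrime (q.under A)) α) (localEtaRoot q) := by
  have h := (isTypeDRoots_etaRoot n g α).map (T := Localization.AtPrime q)
    (IsScalarTower.toAlgHom A (DSplit n g α) (Localization.AtPrime q))
  exact h.of_isScalarTower

theorem isEssGenerating_localEtaRoot :
    IsEssGenerating (Localization.AtPrime (q.under A)) (Set.range (localEtaRoot q)) := by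
  have h := isEssGenerating_of_isLocalization (Localization.AtPrime (q.under A))
    (S := Localization.AtPrime q) q.primeCompl (adjoin_range_etaRoot n g α)
  rwa [← Set.range_comp] at h

end Localization

section Normality

variable {A : Type*} [CommRing A]

theorem exists_maximalIdeal_eq_span_of_isSquarefreeElt [IsNoetherianRing A] [IsNormalRing A]
    {a : A} (hsq : IsSquarefreeElt a) (x : PrimeSpectrum A) (hx : x.asIdeal.height ≤ 1) :
    ∃ π, maximalIdeal (Localization.AtPrime x.asIdeal) = Ideal.span {π} ∧
      algebraMap A (Localization.AtPrime x.asIdeal) a ∣ π := by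
  obtain hx | hx := hx.lt_or_eq
  · have hdim := IsLocalization.AtPrime.ringKrullDim_eq_height x.asIdeal
      (Localization.AtPrime x.asIdeal)
    rw [Order.lt_one_iff.1 hx] at hdim
    have : Ring.KrullDimLE 0 (Localization.AtPrime x.asIdeal) := Ring.krullDimLE_iff.2 hdim.le
    refine ⟨0, ?_, dvd_zero _⟩
    rw [isField_iff_maximalIdeal_eq.1 Ring.KrullDimLE.isField_of_isDomain,
      Ideal.span_singleton_zero]
  · let := isDiscreteValuationRing_localization A x hx
    obtain ⟨π, hπ⟩ := IsDiscreteValuationRing.exists_irreducible (Localization.AtPrime x.asIdeal)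
    refine ⟨π, hπ.maximalIdeal_eq, ?_⟩
    rw [← IsDiscreteValuationRing.addVal_le_iff_dvd, IsDiscreteValuationRing.addVal_uniformizer hπ]
    obtain h | h := hsq x hx
    · exact (le_of_eq h).trans zero_le_one
    · exact le_of_eq h

variable {n : ℕ} {g : A[X]} {α : A}

theorem isNormalRing_dSplit [IsNoetherianRing A] [IsNormalRing A] (h2 : IsUnit (2 : A))
    (hg : g.Monic) (hgn : g.natDegree = n) (hα : α ^ 2 = (-1) ^ n * g.coeff 0)
    (hΔ : reducedDiscr g α ∈ A⁰) (hsq : IsSquarefreeElt (reducedDiscr g α))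
    (hE : CodimGE 2 (badLocus n g α)) : IsNormalRing (DSplit n g α) := by
  have := flat_dSplit h2 hg hgn hα
  refine isNormalRing_of_flat (A := A) fun q _ hq ↦ ?_
  let := Localization.AtPrime.algebraOfLiesOver (q.under A) q
  have := isLocalHom_of_isLiesOverAlgebra q
  let x : PrimeSpectrum A := ⟨q.under A, inferInstance⟩
  have : IsDomain (Localization.AtPrime (q.under A)) := IsNormalRing.isDomain_localization x
  have : IsNoetherianRing (Localization.AtPrime q) :=
    IsLocalization.isNoetherianRing q.primeCompl _ inferInstance
  obtain ⟨π, hπ, hdvd⟩ : ∃ π, maximalIdeal (Localization.AtPrime (q.under A)) = Ideal.span {π} ∧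
      algebraMap A (Localization.AtPrime (q.under A)) (reducedDiscr g α) ∣ π :=
    exists_maximalIdeal_eq_span_of_isSquarefreeElt hsq x hq
  have hne : algebraMap A (Localization.AtPrime (q.under A)) (reducedDiscr g α) ≠ 0 :=
    nonZeroDivisors.ne_zero (IsLocalization.map_nonZeroDivisors_le (q.under A).primeCompl _
      ⟨_, hΔ, rfl⟩)
  rw [map_reducedDiscr _ hg] at hne hdvd
  have h2q := h2.map (algebraMap A (Localization.AtPrime q))
  rw [map_ofNat] at h2q
  refine (isTypeDRoots_localEtaRoot q).isDomain_and_isIntegrallyClosed (hg.map _) h2q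
    (isEssGenerating_localEtaRoot q) hπ hne hdvd fun s s' hss hs hs' ↦ ?_
  rw [rootDegeneracy_localEtaRoot_mem_iff] at hs hs'
  have hcodim : 2 ≤ (q.under A).height :=
    hE x ⟨⟨q, inferInstance⟩, ⟨s, s', hss, hs, hs'⟩, rfl⟩
  exact absurd (hcodim.trans hq) (by norm_num)

end Normality

/-! ### Order of vanishing of the reduced discriminant -/

section Vanishing

variable {A : Type*} [CommRing A]

theorem isSquarefreeElt_of_codimGE_doubleVanishing [IsNoetherianRing A] [IsNormalRing A] {a : A}
    (h : CodimGE 2 (doubleVanishing a)) : IsSquarefreeElt a := by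
  intro x hx
  let := isDiscreteValuationRing_localization A x hx
  obtain ⟨π, hπ⟩ := IsDiscreteValuationRing.exists_irreducible (Localization.AtPrime x.asIdeal)
  by_contra! hne
  have hval : (2 : ℕ∞) ≤ primeVal x hx a := by
    have hlt : (1 : ℕ∞) < primeVal x hx a :=
      (Order.one_le_iff_ne_zero.2 hne.1).lt_of_ne hne.2.symm
    simpa [one_add_one_eq_two] using Order.add_one_le_of_lt hlt
  have hdvd : π ^ 2 ∣ algebraMap A (Localization.AtPrime x.asIdeal) a := by
    rw [← IsDiscreteValuationRing.addVal_le_iff_dvd, IsDiscreteValuationRing.addVal_pow,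
      IsDiscreteValuationRing.addVal_uniformizer hπ, two_nsmul, one_add_one_eq_two]
    exact hval
  have hmem : x ∈ doubleVanishing a := by
    rwa [doubleVanishing, Set.mem_ofPred_eq, hπ.maximalIdeal_eq, Ideal.span_singleton_pow,
      Ideal.mem_span_singleton]
  have hcodim := h x hmem
  rw [hx] at hcodim
  exact absurd hcodim (by norm_num)

variable {n : ℕ} {g : A[X]} {α : A} {x : PrimeSpectrum A}

theorem reducedDiscr_mem_of_mem_badLocus (hg : g.Monic) (hx : x ∈ badLocus n g α) :
    reducedDiscr g α ∈ x.asIdeal := by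
  obtain ⟨y, ⟨s, _, _, hs, _⟩, rfl⟩ := hx
  rw [degeneracy_eq_rootDegeneracy] at hs
  exact y.asIdeal.mem_of_dvd ((isTypeDRoots_etaRoot n g α).rootDegeneracy_dvd hg s) hs

theorem mem_doubleVanishing_of_mem_badLocus [IsNoetherianRing A] [IsNormalRing A] (hg : g.Monic)
    (hx : x ∈ badLocus n g α) (hx1 : x.asIdeal.height = 1) :
    x ∈ doubleVanishing (reducedDiscr g α) := by
  obtain ⟨⟨q, hq⟩, ⟨s, s', hss, hs, hs'⟩, rfl⟩ := hx
  let x : PrimeSpectrum A := ⟨q.under A, inferInstance⟩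
  have : IsDomain (Localization.AtPrime (q.under A)) := IsNormalRing.isDomain_localization x
  have : IsDiscreteValuationRing (Localization.AtPrime (q.under A)) :=
    isDiscreteValuationRing_localization A x hx1
  let := Localization.AtPrime.algebraOfLiesOver (q.under A) q
  have := isLocalHom_of_isLiesOverAlgebra q
  have hmem := (isTypeDRoots_localEtaRoot q).reducedDiscr_mem_maximalIdeal_sq (hg.map _) hss
    ((rootDegeneracy_localEtaRoot_mem_iff q s).2 hs)
    ((rootDegeneracy_localEtaRoot_mem_iff q s').2 hs')
  rwa [← map_reducedDiscr _ hg] at hmem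

theorem codimGE_badLocus [IsNoetherianRing A] [IsNormalRing A] (hg : g.Monic)
    (hΔ : reducedDiscr g α ∈ A⁰) (h : CodimGE 2 (doubleVanishing (reducedDiscr g α))) :
    CodimGE 2 (badLocus n g α) := by
  intro x hx
  have hne0 : x.asIdeal.height ≠ 0 := fun h0 ↦
    Set.disjoint_left.1 (Ideal.disjoint_nonZeroDivisors_of_mem_minimalPrimes
      (Ideal.height_eq_zero_iff.1 h0)) (reducedDiscr_mem_of_mem_badLocus hg hx) hΔ
  obtain h1 | h1 := eq_or_ne x.asIdeal.height 1
  · exact h x (mem_doubleVanishing_of_mem_badLocus hg hx h1)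
  · have hlt : 1 < x.asIdeal.height := (Order.one_le_iff_ne_zero.2 hne0).lt_of_ne h1.symm
    simpa [one_add_one_eq_two] using Order.add_one_le_of_lt hlt

end Vanishing

end TypeD

end

theorem mainTheorem7 {A : Type*} [CommRing A] [IsNoetherianRing A] [TypeD.IsNormalRing A]
    (h2 : IsUnit (2 : A)) (n : ℕ) (g : Polynomial A) (hg : g.Monic) (hgn : g.natDegree = n)
    (α : A) (hα : α ^ 2 = (-1) ^ n * g.coeff 0)
    (hΔ : TypeD.reducedDiscr g α ∈ nonZeroDivisors A) :
    (TypeD.IsSquarefreeElt (TypeD.reducedDiscr g α) →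
        TypeD.CodimGE 2 (TypeD.badLocus n g α) →
        TypeD.IsNormalRing (TypeD.DSplit n g α)) ∧
      (TypeD.CodimGE 2 (TypeD.doubleVanishing (TypeD.reducedDiscr g α)) →
        TypeD.IsSquarefreeElt (TypeD.reducedDiscr g α) ∧
          TypeD.IsNormalRing (TypeD.DSplit n g α)) := by
  refine ⟨TypeD.isNormalRing_dSplit h2 hg hgn hα hΔ, fun hV ↦ ?_⟩
  have hsq := TypeD.isSquarefreeElt_of_codimGE_doubleVanishing hV
  exact ⟨hsq, TypeD.isNormalRing_dSplit h2 hg hgn hα hΔ hsq (TypeD.codimGE_badLocus hg hΔ hV)⟩
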